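/- An associative dialgebra over a field is a vector space with two bilinear operations $\dashv,\vdash$ such that $(x\vdash y)\vdash z=(x\dashv y)\vdash z$, $x\dashv(y\dashv z)=x\dashv(y\vdash z)$, $(x\dashv y)\dashv z=x\dashv(y\dashv z)$, $(x\vdash y)\vdash z=x\vdash(y\vdash z)$ and $(x\vdash y)\dashv z=x\vdash(y\dashv z)$. If $D$ is an associative dialgebra over $\mathbb{Q}$, then $D^+$ denotes the vector space $D$ with the quasi-Jordan product $xy=\tfrac12(x\dashv y+y\vdash x)$. A quasi-Jordan algebra over $\mathbb{Q}$ is a nonassociative algebra satisfying $x(yz)=x(zy)$ and $(yx)x^2=(yx^2)x$; it is semispecial if it also satisfies $(y,x^2,z)=2(y,x,z)x$, where $(x,y,z)=(xy)z-x(yz)$; it is special if it is isomorphic to a subalgebra of $D^+$ for some associative dialgebra $D$. A special identity is a nonassociative polynomial that vanishes identically on every special quasi-Jordan algebra but not on every semispecial quasi-Jordan algebra. Let $f(a,b,c)$ be the following element of the free nonassociative $\mathbb{Q}$-algebra on $a,b,c$, where omitted parentheses in a product associate to the left (so $aab(ac)=((aa)b)(ac)$), and consecutive lines are added: $2\,aaaabbcb-2\,aaababcb+2\,aaabbabc-2\,aaabbbac+2\,aaabbbca$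 $-2\,aaabbcab-2\,aaabbcba+4\,aaabcbba+2\,aaacbabb-4\,aaacbbab$ $-2\,aabaabbc+4\,aabababc-2\,aababbac-2\,aababcab+2\,aababcba$ $+2\,aabacabb-2\,aabacbab+2\,aabbcbaa-2\,aabcbaab+2\,aabcbaba$ $-2\,aabcbbaa+2\,abaaabbc-2\,abaababc-2\,abaabacb-2\,abaabcba$ $-2\,abaacabb+2\,abaacbab-4\,ababaabc+2\,ababaacb+4\,abababac$ $+4\,ababacab-2\,ababbaca+2\,ababcaab-6\,ababcaba-2\,abacaabb$ $+4\,abacabab-2\,abacabba+2\,abacbaab+2\,abacbbaa+2\,abbabcaa$ $-2\,abbacaab+2\,abbacaba-2\,abbacbaa+2\,abbcabaa-2\,abbcbaaa$ $-2\,abcabaab+2\,abcababa-2\,abcabbaa+2\,abcbaaab-2\,abcbaaba$ $+2\,abcbbaaa+2\,acaababb-2\,acaabbab+2\,acaabbba-2\,acabaabb$ $+2\,acababab-4\,acababba+2\,acabbaab+2\,acabbaba-2\,acabbbaa$ $-2\,acbabaab+2\,acbababa+2\,acbabbaa-2\,acbbabaa-2\,a(aa)abbcb$ $+2\,a(aa)babcb-2\,a(aa)bbabc+2\,a(aa)bbbac-2\,a(aa)bbbca+2\,a(aa)bbcab$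 $+2\,a(aa)bbcba-4\,a(aa)bcbba-2\,a(aa)cbabb+4\,a(aa)cbbab-2\,a(ab)aabbc$ $-2\,a(ab)aacbb+2\,a(ab)ababc+4\,a(ab)abacb-2\,a(ab)abcab+2\,a(ab)abcba$ $+4\,a(ab)acabb-4\,a(ab)acbab+2\,a(ab)acbba+4\,a(ab)baabc-6\,a(ab)babac$ $+2\,a(ab)babca-4\,a(ab)bacab-2\,a(ab)bacba+2\,a(ab)bbaca-2\,a(ab)bbcaa$ $-2\,a(ab)bcaab+6\,a(ab)bcaba+2\,a(ab)caabb-2\,a(ab)cabab-2\,a(ab)cbaba$ $-4\,a(ac)ababb+4\,a(ac)abbab-2\,a(ac)abbba+2\,a(ac)baabb-2\,a(ac)bbaba$ $+2\,a(ac)bbbaa+a(bb)aaacb-a(bb)aacab-a(bb)abaac+a(bb)abaca$ $+a(bb)abcaa-a(bb)acbaa-a(bb)bcaaa+a(bb)cbaaa+2\,a(bc)abaab$ $-2\,a(bc)ababa+2\,a(bc)babaa+2\,aa(ab)abbc-2\,aa(ab)abcb+4\,aa(ab)acbb$ $-2\,aa(ab)babc-4\,aa(ab)bacb+2\,aa(ab)bbac-2\,aa(ab)bbca+6\,aa(ab)bcab$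 $-4\,aa(ab)cabb+4\,aa(ab)cbab-2\,aa(ab)cbba-3\,aa(bb)aacb+2\,aa(bb)abac$ $-2\,aa(bb)abca+2\,aa(bb)acab+2\,aa(bb)acba-aa(bb)baca+2\,aa(bb)caab$ $-2\,aa(bb)caba+aa(bb)cbaa+2\,ab(ac)aabb-2\,ab(ac)abab+2\,ab(ac)abba$ $-2\,ab(ac)baab+2\,ab(ac)baba-2\,ab(ac)bbaa-2\,ab(bc)aaab+2\,ab(bc)aaba$ $-2\,ab(bc)abaa-2\,ab(bc)baaa+2\,aaa(ab)bcb-2\,aaa(ab)cbb-3\,aaa(bb)abc$ $+4\,aaa(bb)acb+2\,aaa(bb)bac+aaa(bb)cab-2\,aaa(bb)cba-2\,aaa(bc)abb$ $+4\,aaa(bc)bab+4\,aab(ac)abb+2\,aab(ac)bab+2\,aab(ac)bba+2\,aab(bc)aab$ $+2\,aab(bc)aba+2\,aba(ab)abc-2\,aba(ab)acb-2\,aba(ab)bac+2\,aba(ab)bca$ $-6\,aba(ab)cab-4\,aba(ac)abb-6\,aba(ac)bab-2\,aba(ac)bba+aba(bb)aca$ $-2\,aba(bb)caa-4\,aba(bc)aab-2\,aba(bc)aba-2\,aba(bc)baa-2\,abb(ac)aba$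 $+2\,abb(ac)baa+2\,abb(bc)aaa-4\,aca(ab)bab+2\,aca(ab)bba-aca(bb)aab$ $-aca(bb)aba+aca(bb)baa+2\,a(aa)(bb)abc-a(aa)(bb)acb-2\,a(aa)(bb)bac$ $+2\,a(aa)(bb)bca-2\,a(aa)(bb)cab+2\,a(aa)(bc)abb-4\,a(aa)(bc)bab-2\,a(ab)(ab)abc$ $+4\,a(ab)(ab)bac-4\,a(ab)(ab)bca+4\,a(ab)(ab)cab+4\,a(ab)(ac)bab+a(ab)(bb)aac$ $-2\,a(ab)(bb)aca+a(ab)(bb)caa+2\,a(ab)(bc)aab+2\,a(ab)(bc)baa+a(ac)(bb)aba$ $-a(ac)(bb)baa+aaaa(bb)bc-2\,aaaa(bb)cb+2\,aaab(ac)bb-2\,aaab(bc)ba$ $-2\,aaba(ab)bc+2\,aaba(ab)cb-4\,aaba(ac)bb-aaba(bb)ac-4\,aaba(bc)ab$ $-2\,aaba(bc)ba-6\,aabb(ac)ab-4\,aabb(ac)ba-2\,aabb(bc)aa-2\,aaca(bb)ab$ $+aaca(bb)ba+2\,abaa(ac)bb+abaa(bb)ac-2\,abaa(bb)ca+4\,abaa(bc)ab$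 $+6\,abab(ac)ab+6\,abab(ac)ba+4\,abab(bc)aa+2\,abba(ab)ca+4\,abba(ac)ab$ $+2\,abba(ac)ba+2\,abba(bc)aa+4\,abca(ab)ab+2\,abca(bb)aa+acaa(bb)ab$ $-acaa(bb)ba-acba(bb)aa+a(aa)a(bb)cb+4\,a(aa)b(bc)ba-2\,a(ab)a(bb)ac$ $+3\,a(ab)a(bb)ca-4\,a(ab)b(ac)ab-4\,a(ab)b(ac)ba-4\,a(ab)b(bc)aa+2\,aaaab(bc)b$ $-2\,aaaba(bb)c-4\,aaaba(bc)b-2\,aaabb(ac)b+2\,aabaa(bb)c+2\,aabaa(bc)b$ $+2\,aabab(bc)a+4\,aabba(ac)b+2\,aabba(bc)a+2\,aabbb(ac)a-2\,aabca(ab)b$ $-abaaa(bb)c+2\,abaab(ac)b+4\,abaab(bc)a+2\,ababa(ab)c-2\,ababa(ac)b$ $-4\,ababa(bc)a+4\,abaca(ab)b+2\,abaca(bb)a-2\,abbaa(ac)b-2\,abbaa(bc)a$ $-6\,abbab(ac)a-2\,abbca(ab)a-2\,abcaa(ab)b-abcaa(bb)a+2\,acaba(ab)b$ $+acaba(bb)a-2\,a(aa)bb(bc)a+a(ab)aa(bb)c-2\,a(ab)ab(ac)b-4\,a(ab)ab(bc)a$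 $-2\,a(ab)ba(ab)c+2\,a(ab)ba(ac)b+4\,a(ab)ba(bc)a+4\,a(ab)bb(ac)a-2\,a(ab)ca(ab)b$ $-a(ab)ca(bb)a-2\,aaaabb(bc)+4\,aaabab(bc)-2\,aababa(bc)+2\,aababb(ac)$ $-2\,aabbab(ac)+2\,aabbca(ab)-aabcaa(bb)-2\,aabcba(ab)+aacaba(bb)$ $+abaaca(bb)-2\,ababab(ac)-2\,ababca(ab)+2\,abacba(ab)+2\,abbaba(ac)$ $-2\,abbaca(ab)+2\,abbcaa(ab)-2\,abcaba(ab)-a(ab)aca(bb)+2\,a(ab)bab(ac)$ $-2\,a(ab)bba(ac)+2\,a(ab)bca(ab)+a(ac)aba(bb)-a(ac)baa(bb)-2\,aa(ab)ab(bc)$ $+2\,aa(ab)ba(bc)$ Then: 1. $f$ has exactly $296$ terms, and every one of its monomials has degree $4$ in $a$, degree $3$ in $b$ and degree $1$ in $c$; in particular $f$ is homogeneous of degree $8$, involves three variables and is linear in $c$. 2. $f$ is a polynomial identity for the quasi-Jordan product: if $A$ denotes the free associative dialgebra over $\mathbb{Q}$ on $a,b,c$, then the value of $f$ in $A^+$ at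 the generators $a,b,c$ is zero, and $f$ vanishes identically on $D^+$ for every associative dialgebra $D$ over $\mathbb{Q}$. 3. $f$ does not follow from the semispecial identities: $f$ does not lie in the $T$-ideal of the free nonassociative $\mathbb{Q}$-algebra on $a,b,c$ (the smallest two-sided ideal stable under all endomorphisms) generated by $a(bc)-a(cb)$, $(ba)a^2-(ba^2)a$ and $(b,a^2,c)-2(b,a,c)a$. 4. $f$ is a special identity over $\mathbb{Q}$. 5. The direct analogue of Macdonald's theorem fails over $\mathbb{Q}$: it is not true that every polynomial $g(x_1,x_2,x_3)$ of degree at most one in $x_3$ that vanishes identically on all special quasi-Jordan algebras vanishes identically on all semispecial quasi-Jordan algebras (and so, a fortiori, not on all quasi-Jordan algebras). -/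

import Mathlib

/-! ### Associative dialgebras and their plus algebras -/

/-- An associative dialgebra over `F`: a vector space with two bilinear operations, the left product
`left a b` (written `a ⊣ b` in the comments) and the right product `right a b` (written `a ⊢ b`). -/
class AssocDialgebra (F : Type*) (D : Type*) [Field F] [AddCommGroup D] [Module F D] where
  left : D →ₗ[F] D →ₗ[F] D
  right : D →ₗ[F] D →ₗ[F] D
  /-- `(a ⊢ b) ⊢ c = (a ⊣ b) ⊢ c` -/
  right_bar : ∀ a b c, right (right a b) c = right (left a b) c
  /-- `a ⊣ (b ⊣ c) = a ⊣ (b ⊢ c)` -/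
  left_bar : ∀ a b c, left a (left b c) = left a (right b c)
  /-- `(a ⊣ b) ⊣ c = a ⊣ (b ⊣ c)` -/
  left_assoc : ∀ a b c, left (left a b) c = left a (left b c)
  /-- `(a ⊢ b) ⊢ c = a ⊢ (b ⊢ c)` -/
  right_assoc : ∀ a b c, right (right a b) c = right a (right b c)
  /-- `(a ⊢ b) ⊣ c = a ⊢ (b ⊣ c)` -/
  inner_assoc : ∀ a b c, left (right a b) c = right a (left b c)

/-- The plus algebra `D⁺`: the vector space `D` with the quasi-Jordan product
`a ◁ b = ½ (a ⊣ b + b ⊢ a)`. -/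
def PlusAlgebra (_F : Type*) (D : Type*) : Type _ := D

noncomputable section

noncomputable section

namespace PlusAlgebra

variable (F : Type*) (D : Type*) [Field F] [AddCommGroup D] [Module F D]

instance : AddCommGroup (PlusAlgebra F D) := inferInstanceAs (AddCommGroup D)

instance : Module F (PlusAlgebra F D) := inferInstanceAs (Module F D)

variable [AssocDialgebra F D]

/-- The quasi-Jordan product as a bilinear map. -/
def quasiJordanMul : D →ₗ[F] D →ₗ[F] D :=
  (2⁻¹ : F) • (AssocDialgebra.left + (AssocDialgebra.right (F := F) (D := D)).flip)

theorem quasiJordanMul_apply (a b : D) : quasiJordanMul F D a b =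
    (2⁻¹ : F) • (AssocDialgebra.left (F := F) a b + AssocDialgebra.right (F := F) b a) := rfl

instance : NonUnitalNonAssocRing (PlusAlgebra F D) :=
  { (inferInstance : AddCommGroup (PlusAlgebra F D)) with
    mul := fun a b => quasiJordanMul F D a b
    left_distrib := fun a b c => map_add (quasiJordanMul F D a) b c
    right_distrib := fun a b c => LinearMap.map_add₂ (quasiJordanMul F D) a b c
    zero_mul := fun a => LinearMap.map_zero₂ (quasiJordanMul F D) a
    mul_zero := fun a => map_zero (quasiJordanMul F D a) }

instance : IsScalarTower F (PlusAlgebra F D) (PlusAlgebra F D) :=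
  ⟨fun r a b => LinearMap.map_smul₂ (quasiJordanMul F D) r a b⟩

instance : SMulCommClass F (PlusAlgebra F D) (PlusAlgebra F D) :=
  ⟨fun r a b => (map_smul (quasiJordanMul F D a) r b).symm⟩

end PlusAlgebra

/-! ### The free associative dialgebra -/

/-- The free associative dialgebra on `X`: the vector space whose basis consists of the monomials
`a₁ ⋯ aₖ₋₁ âₖ aₖ₊₁ ⋯ aₙ` in normal form, encoded as triples (letters to the left of the center,
center, letters to the right of the center).  Its freeness is `FreeDialgebra.existsUnique_lift`. -/
abbrev FreeDialgebra (F : Type*) (X : Type*) [Field F] : Type _ := (List X × X × List X) →₀ F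

namespace FreeDialgebra

variable (F : Type*) {X : Type*} [Field F]

/-- Left product of monomials: the center is that of the left factor. -/
def leftMon (p q : List X × X × List X) : List X × X × List X :=
  (p.1, p.2.1, p.2.2 ++ (q.1 ++ q.2.1 :: q.2.2))

/-- Right product of monomials: the center is that of the right factor. -/
def rightMon (p q : List X × X × List X) : List X × X × List X :=
  ((p.1 ++ p.2.1 :: p.2.2) ++ q.1, q.2.1, q.2.2)

/-- The bilinear extension of an operation on monomials. -/
def extend (o : List X × X × List X → List X × X × List X → List X × X × List X) :
    FreeDialgebra F X →ₗ[F] FreeDialgebra F X →ₗ[F] FreeDialgebra F X :=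
  Finsupp.linearCombination F fun p => Finsupp.lmapDomain F F (o p)

theorem extend_single (o : List X × X × List X → List X × X × List X → List X × X × List X)
    (p q : List X × X × List X) (r s : F) :
    extend F o (Finsupp.single p r) (Finsupp.single q s) = Finsupp.single (o p q) (r * s) := by
  simp [extend, Finsupp.linearCombination_single, Finsupp.mapDomain_single]

theorem extend_assoc {o o' u u' : List X × X × List X → List X × X × List X →
    List X × X × List X} (h : ∀ p q r, o (o' p q) r = u p (u' q r)) (a b c : FreeDialgebra F X) :
    extend F o (extend F o' a b) c = extend F u a (extend F u' b c) := by
  refine Finsupp.induction_linear a (by simp) (fun x y hx hy => by simp [hx, hy]) fun p i => ?_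
  refine Finsupp.induction_linear b (by simp) (fun x y hx hy => by simp [hx, hy]) fun q j => ?_
  refine Finsupp.induction_linear c (by simp) (fun x y hx hy => by simp [hx, hy]) fun r k => ?_
  simp only [extend_single, h, mul_assoc]

theorem extend_left_congr {o o' u : List X × X × List X → List X × X × List X →
    List X × X × List X} (h : ∀ p q r, o (o' p q) r = o (u p q) r) (a b c : FreeDialgebra F X) :
    extend F o (extend F o' a b) c = extend F o (extend F u a b) c := by
  refine Finsupp.induction_linear a (by simp) (fun x y hx hy => by simp [hx, hy]) fun p i => ?_
  refine Finsupp.induction_linear b (by simp) (fun x y hx hy => by simp [hx, hy]) fun q j => ?_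
  refine Finsupp.induction_linear c (by simp) (fun x y hx hy => by simp [hx, hy]) fun r k => ?_
  simp only [extend_single, h]

theorem extend_right_congr {o o' u : List X × X × List X → List X × X × List X →
    List X × X × List X} (h : ∀ p q r, o p (o' q r) = o p (u q r)) (a b c : FreeDialgebra F X) :
    extend F o a (extend F o' b c) = extend F o a (extend F u b c) := by
  refine Finsupp.induction_linear a (by simp) (fun x y hx hy => by simp [hx, hy]) fun p i => ?_
  refine Finsupp.induction_linear b (by simp) (fun x y hx hy => by simp [hx, hy]) fun q j => ?_
  refine Finsupp.induction_linear c (by simp) (fun x y hx hy => by simp [hx, hy]) fun r k => ?_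
  simp only [extend_single, h]

instance : AssocDialgebra F (FreeDialgebra F X) where
  left := extend F leftMon
  right := extend F rightMon
  right_bar := extend_left_congr F fun p q r => by simp [leftMon, rightMon]
  left_bar := extend_right_congr F fun p q r => by simp [leftMon, rightMon]
  left_assoc := extend_assoc F fun p q r => by simp [leftMon]
  right_assoc := extend_assoc F fun p q r => by simp [rightMon]
  inner_assoc := extend_assoc F fun p q r => by simp [leftMon, rightMon]

/-- The generator `x`. -/
def of (x : X) : FreeDialgebra F X := Finsupp.single ([], x, []) 1

section Lift

variable {F} {D : Type*} [AddCommGroup D] [Module F D] [AssocDialgebra F D]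

open AssocDialgebra

/-- `u₁ ⊢ (u₂ ⊢ ⋯ (uₖ ⊢ d))` -/
def mulRights (φ : X → D) (u : List X) (d : D) : D :=
  u.foldr (fun y e => right (F := F) (φ y) e) d

/-- `((d ⊣ v₁) ⊣ v₂) ⋯ ⊣ vₖ` -/
def mulLefts (φ : X → D) (d : D) (v : List X) : D :=
  v.foldl (fun e y => left (F := F) e (φ y)) d

theorem left_mulRights (φ : X → D) (u : List X) (d e : D) :
    left (F := F) (mulRights (F := F) φ u d) e = mulRights (F := F) φ u (left (F := F) d e) := by
  induction u with
  | nil => rfl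
  | cons y u ih => simp only [mulRights, List.foldr_cons] at ih ⊢; rw [inner_assoc, ih]

theorem right_mulLefts (φ : X → D) (v : List X) (d e : D) :
    right (F := F) e (mulLefts (F := F) φ d v) = mulLefts (F := F) φ (right (F := F) e d) v := by
  induction v generalizing d with
  | nil => rfl
  | cons y v ih => simp only [mulLefts, List.foldl_cons] at ih ⊢; rw [ih, inner_assoc]

theorem mulLefts_mulRights (φ : X → D) (u v : List X) (d : D) :
    mulLefts (F := F) φ (mulRights (F := F) φ u d) v =
      mulRights (F := F) φ u (mulLefts (F := F) φ d v) := by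
  induction v generalizing d with
  | nil => rfl
  | cons y v ih =>
    have := ih (left (F := F) d (φ y))
    simp only [mulLefts, List.foldl_cons] at this ⊢
    rw [left_mulRights, this]

theorem left_of_mulLefts (φ : X → D) (v : List X) (d e : D) :
    left (F := F) d (mulLefts (F := F) φ e v) = mulLefts (F := F) φ (left (F := F) d e) v := by
  induction v generalizing e with
  | nil => rfl
  | cons y v ih => simp only [mulLefts, List.foldl_cons] at ih ⊢; rw [ih, left_assoc]

theorem left_of_mulRights (φ : X → D) (u : List X) (d e : D) :
    left (F := F) d (mulRights (F := F) φ u e) =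
      left (F := F) (mulLefts (F := F) φ d u) e := by
  induction u generalizing d with
  | nil => rfl
  | cons y u ih =>
    simp only [mulLefts, mulRights, List.foldl_cons, List.foldr_cons] at ih ⊢
    rw [← left_bar, ← left_assoc, ih]

theorem right_of_mulRights (φ : X → D) (u : List X) (d e : D) :
    right (F := F) (mulRights (F := F) φ u d) e =
      mulRights (F := F) φ u (right (F := F) d e) := by
  induction u with
  | nil => rfl
  | cons y u ih => simp only [mulRights, List.foldr_cons] at ih ⊢; rw [right_assoc, ih]

theorem right_of_mulLefts (φ : X → D) (v : List X) (d e : D) :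
    right (F := F) (mulLefts (F := F) φ d v) e =
      right (F := F) d (mulRights (F := F) φ v e) := by
  induction v generalizing d with
  | nil => rfl
  | cons y v ih =>
    simp only [mulLefts, mulRights, List.foldl_cons, List.foldr_cons] at ih ⊢
    rw [ih, ← right_bar, right_assoc]

/-- The value of a monomial under a substitution of the generators. -/
def evalMon (φ : X → D) (p : List X × X × List X) : D :=
  mulRights (F := F) φ p.1 (mulLefts (F := F) φ (φ p.2.1) p.2.2)

theorem evalMon_leftMon (φ : X → D) (p q : List X × X × List X) :
    evalMon (F := F) φ (leftMon p q) =
      left (F := F) (evalMon (F := F) φ p) (evalMon (F := F) φ q) := by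
  simp only [evalMon, left_of_mulRights, left_of_mulLefts]
  rw [← mulLefts_mulRights, ← mulLefts_mulRights]
  simp [leftMon, mulLefts]

theorem evalMon_rightMon (φ : X → D) (p q : List X × X × List X) :
    evalMon (F := F) φ (rightMon p q) =
      right (F := F) (evalMon (F := F) φ p) (evalMon (F := F) φ q) := by
  simp only [evalMon, right_of_mulRights, right_of_mulLefts]
  simp [rightMon, mulRights]

/-- The universal property: every map from `X` to an associative dialgebra extends uniquely to a
homomorphism of dialgebras on `FreeDialgebra F X`. -/
theorem existsUnique_lift (φ : X → D) : ∃! f : FreeDialgebra F X →ₗ[F] D,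
    (∀ x, f (of F x) = φ x) ∧
    (∀ a b, f (left (F := F) a b) = left (F := F) (f a) (f b)) ∧
    (∀ a b, f (right (F := F) a b) = right (F := F) (f a) (f b)) := by
  have hl : ∀ p q : List X × X × List X, left (F := F) (Finsupp.single p (1 : F))
      (Finsupp.single q (1 : F)) = Finsupp.single (leftMon p q) (1 : F) := fun p q =>
    (extend_single F leftMon p q 1 1).trans (by rw [mul_one])
  have hr : ∀ p q : List X × X × List X, right (F := F) (Finsupp.single p (1 : F))
      (Finsupp.single q (1 : F)) = Finsupp.single (rightMon p q) (1 : F) := fun p q =>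
    (extend_single F rightMon p q 1 1).trans (by rw [mul_one])
  refine ⟨Finsupp.linearCombination F (evalMon (F := F) φ), ⟨fun x => ?_, fun a b => ?_,
    fun a b => ?_⟩, fun g ⟨h0, h1, h2⟩ => ?_⟩
  · simp [of, evalMon, mulRights, mulLefts]
  · refine Finsupp.induction_linear a (by simp) (fun x y hx hy => by simp [hx, hy]) fun p i => ?_
    refine Finsupp.induction_linear b (by simp) (fun x y hx hy => by simp [hx, hy]) fun q j => ?_
    refine (congrArg _ (extend_single F leftMon p q i j)).trans ?_
    simp only [Finsupp.linearCombination_single, evalMon_leftMon, map_smul, LinearMap.smul_apply,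
      mul_smul]
    exact smul_comm _ _ _
  · refine Finsupp.induction_linear a (by simp) (fun x y hx hy => by simp [hx, hy]) fun p i => ?_
    refine Finsupp.induction_linear b (by simp) (fun x y hx hy => by simp [hx, hy]) fun q j => ?_
    refine (congrArg _ (extend_single F rightMon p q i j)).trans ?_
    simp only [Finsupp.linearCombination_single, evalMon_rightMon, map_smul, LinearMap.smul_apply,
      mul_smul]
    exact smul_comm _ _ _
  · have h3 : ∀ (v : List X) (x : X), g (Finsupp.single ([], x, v) 1) =
        mulLefts (F := F) φ (φ x) v := by
      intro v x
      induction v using List.reverseRecOn with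
      | nil => exact h0 x
      | append_singleton v y ih =>
        have := h1 (Finsupp.single ([], x, v) 1) (of F y)
        rw [of, hl, ih] at this
        simpa [leftMon, mulLefts, ← h0 y, of] using this
    have h4 : ∀ (u v : List X) (x : X), g (Finsupp.single (u, x, v) 1) =
        evalMon (F := F) φ (u, x, v) := by
      intro u v x
      induction u with
      | nil => exact h3 v x
      | cons y u ih =>
        have := h2 (of F y) (Finsupp.single (u, x, v) 1)
        rw [of, hr, ih] at this
        simpa [rightMon, evalMon, mulRights, ← h0 y, of] using this
    refine Finsupp.lhom_ext' fun p => LinearMap.ext_ring ?_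
    simpa using h4 p.1 p.2.2 p.2.1

end Lift

end FreeDialgebra

end

/-! ### Quasi-Jordan algebras -/

/-- The identities of quasi-Jordan algebras (the base field has characteristic different from `2`
and `3`): right commutativity and the quasi-Jordan identity. -/
structure IsQuasiJordan (A : Type*) [NonUnitalNonAssocRing A] : Prop where
  right_comm : ∀ a b c : A, a * (b * c) = a * (c * b)
  quasi_jordan : ∀ a b : A, (b * a) * (a * a) = (b * (a * a)) * a

/-- Semispecial quasi-Jordan algebras: quasi-Jordan algebras with the associator-derivation identity
`(b, a², c) = 2 (b, a, c) a`, where `(a, b, c) = (ab)c - a(bc)`. -/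
structure IsSemispecial (A : Type*) [NonUnitalNonAssocRing A] : Prop extends IsQuasiJordan A where
  associator_derivation : ∀ a b c : A, associator b (a * a) c = 2 • (associator b a c * a)

universe u

/-- Special algebras: those isomorphic to a subalgebra of `D⁺` for an associative dialgebra `D`. -/
def IsSpecial (F : Type*) [Field F] (A : Type u) [NonUnitalNonAssocRing A] [Module F A] : Prop :=
  ∃ (D : Type u) (_ : AddCommGroup D) (_ : Module F D) (_ : AssocDialgebra F D)
    (φ : A →ₙₐ[F] PlusAlgebra F D), Function.Injective φ

/-! ### Polynomial identities -/

/-- The nonassociative polynomial `f` vanishes under all substitutions in `A`. -/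
def Satisfies {F : Type*} [Field F] {X : Type*} (A : Type*) [NonUnitalNonAssocRing A] [Module F A]
    [IsScalarTower F A A] [SMulCommClass F A A] (f : FreeNonUnitalNonAssocAlgebra F X) : Prop :=
  ∀ x : X → A, FreeNonUnitalNonAssocAlgebra.lift F x f = 0

/-- `f` is satisfied by all special quasi-Jordan algebras over `F`. -/
def HoldsInSpecial {F : Type*} [Field F] {X : Type*} (f : FreeNonUnitalNonAssocAlgebra F X) :
    Prop :=
  ∀ (A : Type u) [NonUnitalNonAssocRing A] [Module F A] [IsScalarTower F A A]
    [SMulCommClass F A A], IsSpecial F A → Satisfies A f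

/-- `f` is satisfied by all semispecial quasi-Jordan algebras over `F`. -/
def HoldsInSemispecial {F : Type*} [Field F] {X : Type*} (f : FreeNonUnitalNonAssocAlgebra F X) :
    Prop :=
  ∀ (A : Type u) [NonUnitalNonAssocRing A] [Module F A] [IsScalarTower F A A]
    [SMulCommClass F A A], IsSemispecial A → Satisfies A f

/-- A special identity: satisfied by all special quasi-Jordan algebras but not by all semispecial
quasi-Jordan algebras. -/
def IsSpecialIdentity {F : Type*} [Field F] {X : Type*} (f : FreeNonUnitalNonAssocAlgebra F X) :
    Prop :=
  HoldsInSpecial.{u} f ∧ ¬ HoldsInSemispecial.{u} f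

/-- Number of occurrences of the generator `x` in a nonassociative monomial. -/
def occ {X : Type*} [DecidableEq X] (x : X) : FreeMagma X → ℕ
  | .of y => if y = x then 1 else 0
  | .mul v w => occ x v + occ x w

/-- The analogue of Macdonald's theorem: an identity in three variables, of degree at most one in
one of them, that holds in all special quasi-Jordan algebras holds in all semispecial ones. -/
def MacdonaldAnalogue (F : Type*) [Field F] : Prop :=
  ∀ f : FreeNonUnitalNonAssocAlgebra F (Fin 3), (∀ m ∈ f.coeff.support, occ 2 m ≤ 1) →
    HoldsInSpecial.{u} f → HoldsInSemispecial.{u} f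

/-- A `T`-ideal of the free nonassociative algebra: a two-sided ideal that is sent to itself by all
endomorphisms. -/
structure IsTIdeal {F : Type*} [Field F] {X : Type*}
    (I : Submodule F (FreeNonUnitalNonAssocAlgebra F X)) : Prop where
  mul_left : ∀ f g, f ∈ I → g * f ∈ I
  mul_right : ∀ f g, f ∈ I → f * g ∈ I
  map_mem : ∀ (φ : FreeNonUnitalNonAssocAlgebra F X →ₙₐ[F] FreeNonUnitalNonAssocAlgebra F X) (f),
    f ∈ I → φ f ∈ I

/-- The `T`-ideal generated by `S`. -/
def tIdeal {F : Type*} [Field F] {X : Type*} (S : Set (FreeNonUnitalNonAssocAlgebra F X)) :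
    Submodule F (FreeNonUnitalNonAssocAlgebra F X) :=
  sInf {I | IsTIdeal I ∧ S ⊆ I}

/-- The defining identities of semispecial quasi-Jordan algebras as polynomials in `a`, `b`, `c`. -/
def semispecialIdentities (F : Type*) [Field F] : Set (FreeNonUnitalNonAssocAlgebra F (Fin 3)) :=
  let a := FreeNonUnitalNonAssocAlgebra.of F (0 : Fin 3)
  let b := FreeNonUnitalNonAssocAlgebra.of F (1 : Fin 3)
  let c := FreeNonUnitalNonAssocAlgebra.of F (2 : Fin 3)
  {a * (b * c) - a * (c * b),
   (b * a) * (a * a) - (b * (a * a)) * a,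
   associator b (a * a) c - 2 • (associator b a c * a)}

/-! ### The special identity -/

/-- Terms 1 to 150 of the special identity, as pairs (coefficient, monomial) in `a`, `b`, `c`.
Products associate to the left: `a*a*b*(a*c)` is `((aa)b)(ac)`. -/
def specialTerms1 {M : Type*} [Mul M] (a b c : M) : List (ℤ × M) :=
  [(2, a*a*a*a*b*b*c*b), (-2, a*a*a*b*a*b*c*b), (2, a*a*a*b*b*a*b*c),
   (-2, a*a*a*b*b*b*a*c), (2, a*a*a*b*b*b*c*a), (-2, a*a*a*b*b*c*a*b),
   (-2, a*a*a*b*b*c*b*a), (4, a*a*a*b*c*b*b*a), (2, a*a*a*c*b*a*b*b),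
   (-4, a*a*a*c*b*b*a*b), (-2, a*a*b*a*a*b*b*c), (4, a*a*b*a*b*a*b*c),
   (-2, a*a*b*a*b*b*a*c), (-2, a*a*b*a*b*c*a*b), (2, a*a*b*a*b*c*b*a),
   (2, a*a*b*a*c*a*b*b), (-2, a*a*b*a*c*b*a*b), (2, a*a*b*b*c*b*a*a),
   (-2, a*a*b*c*b*a*a*b), (2, a*a*b*c*b*a*b*a), (-2, a*a*b*c*b*b*a*a),
   (2, a*b*a*a*a*b*b*c), (-2, a*b*a*a*b*a*b*c), (-2, a*b*a*a*b*a*c*b),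
   (-2, a*b*a*a*b*c*b*a), (-2, a*b*a*a*c*a*b*b), (2, a*b*a*a*c*b*a*b),
   (-4, a*b*a*b*a*a*b*c), (2, a*b*a*b*a*a*c*b), (4, a*b*a*b*a*b*a*c),
   (4, a*b*a*b*a*c*a*b), (-2, a*b*a*b*b*a*c*a), (2, a*b*a*b*c*a*a*b),
   (-6, a*b*a*b*c*a*b*a), (-2, a*b*a*c*a*a*b*b), (4, a*b*a*c*a*b*a*b),
   (-2, a*b*a*c*a*b*b*a), (2, a*b*a*c*b*a*a*b), (2, a*b*a*c*b*b*a*a),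
   (2, a*b*b*a*b*c*a*a), (-2, a*b*b*a*c*a*a*b), (2, a*b*b*a*c*a*b*a),
   (-2, a*b*b*a*c*b*a*a), (2, a*b*b*c*a*b*a*a), (-2, a*b*b*c*b*a*a*a),
   (-2, a*b*c*a*b*a*a*b), (2, a*b*c*a*b*a*b*a), (-2, a*b*c*a*b*b*a*a),
   (2, a*b*c*b*a*a*a*b), (-2, a*b*c*b*a*a*b*a), (2, a*b*c*b*b*a*a*a),
   (2, a*c*a*a*b*a*b*b), (-2, a*c*a*a*b*b*a*b), (2, a*c*a*a*b*b*b*a),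
   (-2, a*c*a*b*a*a*b*b), (2, a*c*a*b*a*b*a*b), (-4, a*c*a*b*a*b*b*a),
   (2, a*c*a*b*b*a*a*b), (2, a*c*a*b*b*a*b*a), (-2, a*c*a*b*b*b*a*a),
   (-2, a*c*b*a*b*a*a*b), (2, a*c*b*a*b*a*b*a), (2, a*c*b*a*b*b*a*a),
   (-2, a*c*b*b*a*b*a*a), (-2, a*(a*a)*a*b*b*c*b), (2, a*(a*a)*b*a*b*c*b),
   (-2, a*(a*a)*b*b*a*b*c), (2, a*(a*a)*b*b*b*a*c), (-2, a*(a*a)*b*b*b*c*a),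
   (2, a*(a*a)*b*b*c*a*b), (2, a*(a*a)*b*b*c*b*a), (-4, a*(a*a)*b*c*b*b*a),
   (-2, a*(a*a)*c*b*a*b*b), (4, a*(a*a)*c*b*b*a*b), (-2, a*(a*b)*a*a*b*b*c),
   (-2, a*(a*b)*a*a*c*b*b), (2, a*(a*b)*a*b*a*b*c), (4, a*(a*b)*a*b*a*c*b),
   (-2, a*(a*b)*a*b*c*a*b), (2, a*(a*b)*a*b*c*b*a), (4, a*(a*b)*a*c*a*b*b),
   (-4, a*(a*b)*a*c*b*a*b), (2, a*(a*b)*a*c*b*b*a), (4, a*(a*b)*b*a*a*b*c),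
   (-6, a*(a*b)*b*a*b*a*c), (2, a*(a*b)*b*a*b*c*a), (-4, a*(a*b)*b*a*c*a*b),
   (-2, a*(a*b)*b*a*c*b*a), (2, a*(a*b)*b*b*a*c*a), (-2, a*(a*b)*b*b*c*a*a),
   (-2, a*(a*b)*b*c*a*a*b), (6, a*(a*b)*b*c*a*b*a), (2, a*(a*b)*c*a*a*b*b),
   (-2, a*(a*b)*c*a*b*a*b), (-2, a*(a*b)*c*b*a*b*a), (-4, a*(a*c)*a*b*a*b*b),
   (4, a*(a*c)*a*b*b*a*b), (-2, a*(a*c)*a*b*b*b*a), (2, a*(a*c)*b*a*a*b*b),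
   (-2, a*(a*c)*b*b*a*b*a), (2, a*(a*c)*b*b*b*a*a), (1, a*(b*b)*a*a*a*c*b),
   (-1, a*(b*b)*a*a*c*a*b), (-1, a*(b*b)*a*b*a*a*c), (1, a*(b*b)*a*b*a*c*a),
   (1, a*(b*b)*a*b*c*a*a), (-1, a*(b*b)*a*c*b*a*a), (-1, a*(b*b)*b*c*a*a*a),
   (1, a*(b*b)*c*b*a*a*a), (2, a*(b*c)*a*b*a*a*b), (-2, a*(b*c)*a*b*a*b*a),
   (2, a*(b*c)*b*a*b*a*a), (2, a*a*(a*b)*a*b*b*c), (-2, a*a*(a*b)*a*b*c*b),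
   (4, a*a*(a*b)*a*c*b*b), (-2, a*a*(a*b)*b*a*b*c), (-4, a*a*(a*b)*b*a*c*b),
   (2, a*a*(a*b)*b*b*a*c), (-2, a*a*(a*b)*b*b*c*a), (6, a*a*(a*b)*b*c*a*b),
   (-4, a*a*(a*b)*c*a*b*b), (4, a*a*(a*b)*c*b*a*b), (-2, a*a*(a*b)*c*b*b*a),
   (-3, a*a*(b*b)*a*a*c*b), (2, a*a*(b*b)*a*b*a*c), (-2, a*a*(b*b)*a*b*c*a),
   (2, a*a*(b*b)*a*c*a*b), (2, a*a*(b*b)*a*c*b*a), (-1, a*a*(b*b)*b*a*c*a),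
   (2, a*a*(b*b)*c*a*a*b), (-2, a*a*(b*b)*c*a*b*a), (1, a*a*(b*b)*c*b*a*a),
   (2, a*b*(a*c)*a*a*b*b), (-2, a*b*(a*c)*a*b*a*b), (2, a*b*(a*c)*a*b*b*a),
   (-2, a*b*(a*c)*b*a*a*b), (2, a*b*(a*c)*b*a*b*a), (-2, a*b*(a*c)*b*b*a*a),
   (-2, a*b*(b*c)*a*a*a*b), (2, a*b*(b*c)*a*a*b*a), (-2, a*b*(b*c)*a*b*a*a),
   (-2, a*b*(b*c)*b*a*a*a), (2, a*a*a*(a*b)*b*c*b), (-2, a*a*a*(a*b)*c*b*b),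
   (-3, a*a*a*(b*b)*a*b*c), (4, a*a*a*(b*b)*a*c*b), (2, a*a*a*(b*b)*b*a*c),
   (1, a*a*a*(b*b)*c*a*b), (-2, a*a*a*(b*b)*c*b*a), (-2, a*a*a*(b*c)*a*b*b)]

/-- Terms 151 to 296 of the special identity. -/
def specialTerms2 {M : Type*} [Mul M] (a b c : M) : List (ℤ × M) :=
  [(4, a*a*a*(b*c)*b*a*b), (4, a*a*b*(a*c)*a*b*b), (2, a*a*b*(a*c)*b*a*b),
   (2, a*a*b*(a*c)*b*b*a), (2, a*a*b*(b*c)*a*a*b), (2, a*a*b*(b*c)*a*b*a),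
   (2, a*b*a*(a*b)*a*b*c), (-2, a*b*a*(a*b)*a*c*b), (-2, a*b*a*(a*b)*b*a*c),
   (2, a*b*a*(a*b)*b*c*a), (-6, a*b*a*(a*b)*c*a*b), (-4, a*b*a*(a*c)*a*b*b),
   (-6, a*b*a*(a*c)*b*a*b), (-2, a*b*a*(a*c)*b*b*a), (1, a*b*a*(b*b)*a*c*a),
   (-2, a*b*a*(b*b)*c*a*a), (-4, a*b*a*(b*c)*a*a*b), (-2, a*b*a*(b*c)*a*b*a),
   (-2, a*b*a*(b*c)*b*a*a), (-2, a*b*b*(a*c)*a*b*a), (2, a*b*b*(a*c)*b*a*a),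
   (2, a*b*b*(b*c)*a*a*a), (-4, a*c*a*(a*b)*b*a*b), (2, a*c*a*(a*b)*b*b*a),
   (-1, a*c*a*(b*b)*a*a*b), (-1, a*c*a*(b*b)*a*b*a), (1, a*c*a*(b*b)*b*a*a),
   (2, a*(a*a)*(b*b)*a*b*c), (-1, a*(a*a)*(b*b)*a*c*b), (-2, a*(a*a)*(b*b)*b*a*c),
   (2, a*(a*a)*(b*b)*b*c*a), (-2, a*(a*a)*(b*b)*c*a*b), (2, a*(a*a)*(b*c)*a*b*b),
   (-4, a*(a*a)*(b*c)*b*a*b), (-2, a*(a*b)*(a*b)*a*b*c), (4, a*(a*b)*(a*b)*b*a*c),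
   (-4, a*(a*b)*(a*b)*b*c*a), (4, a*(a*b)*(a*b)*c*a*b), (4, a*(a*b)*(a*c)*b*a*b),
   (1, a*(a*b)*(b*b)*a*a*c), (-2, a*(a*b)*(b*b)*a*c*a), (1, a*(a*b)*(b*b)*c*a*a),
   (2, a*(a*b)*(b*c)*a*a*b), (2, a*(a*b)*(b*c)*b*a*a), (1, a*(a*c)*(b*b)*a*b*a),
   (-1, a*(a*c)*(b*b)*b*a*a), (1, a*a*a*a*(b*b)*b*c), (-2, a*a*a*a*(b*b)*c*b),
   (2, a*a*a*b*(a*c)*b*b), (-2, a*a*a*b*(b*c)*b*a), (-2, a*a*b*a*(a*b)*b*c),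
   (2, a*a*b*a*(a*b)*c*b), (-4, a*a*b*a*(a*c)*b*b), (-1, a*a*b*a*(b*b)*a*c),
   (-4, a*a*b*a*(b*c)*a*b), (-2, a*a*b*a*(b*c)*b*a), (-6, a*a*b*b*(a*c)*a*b),
   (-4, a*a*b*b*(a*c)*b*a), (-2, a*a*b*b*(b*c)*a*a), (-2, a*a*c*a*(b*b)*a*b),
   (1, a*a*c*a*(b*b)*b*a), (2, a*b*a*a*(a*c)*b*b), (1, a*b*a*a*(b*b)*a*c),
   (-2, a*b*a*a*(b*b)*c*a), (4, a*b*a*a*(b*c)*a*b), (6, a*b*a*b*(a*c)*a*b),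
   (6, a*b*a*b*(a*c)*b*a), (4, a*b*a*b*(b*c)*a*a), (2, a*b*b*a*(a*b)*c*a),
   (4, a*b*b*a*(a*c)*a*b), (2, a*b*b*a*(a*c)*b*a), (2, a*b*b*a*(b*c)*a*a),
   (4, a*b*c*a*(a*b)*a*b), (2, a*b*c*a*(b*b)*a*a), (1, a*c*a*a*(b*b)*a*b),
   (-1, a*c*a*a*(b*b)*b*a), (-1, a*c*b*a*(b*b)*a*a), (1, a*(a*a)*a*(b*b)*c*b),
   (4, a*(a*a)*b*(b*c)*b*a), (-2, a*(a*b)*a*(b*b)*a*c), (3, a*(a*b)*a*(b*b)*c*a),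
   (-4, a*(a*b)*b*(a*c)*a*b), (-4, a*(a*b)*b*(a*c)*b*a), (-4, a*(a*b)*b*(b*c)*a*a),
   (2, a*a*a*a*b*(b*c)*b), (-2, a*a*a*b*a*(b*b)*c), (-4, a*a*a*b*a*(b*c)*b),
   (-2, a*a*a*b*b*(a*c)*b), (2, a*a*b*a*a*(b*b)*c), (2, a*a*b*a*a*(b*c)*b),
   (2, a*a*b*a*b*(b*c)*a), (4, a*a*b*b*a*(a*c)*b), (2, a*a*b*b*a*(b*c)*a),
   (2, a*a*b*b*b*(a*c)*a), (-2, a*a*b*c*a*(a*b)*b), (-1, a*b*a*a*a*(b*b)*c),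
   (2, a*b*a*a*b*(a*c)*b), (4, a*b*a*a*b*(b*c)*a), (2, a*b*a*b*a*(a*b)*c),
   (-2, a*b*a*b*a*(a*c)*b), (-4, a*b*a*b*a*(b*c)*a), (4, a*b*a*c*a*(a*b)*b),
   (2, a*b*a*c*a*(b*b)*a), (-2, a*b*b*a*a*(a*c)*b), (-2, a*b*b*a*a*(b*c)*a),
   (-6, a*b*b*a*b*(a*c)*a), (-2, a*b*b*c*a*(a*b)*a), (-2, a*b*c*a*a*(a*b)*b),
   (-1, a*b*c*a*a*(b*b)*a), (2, a*c*a*b*a*(a*b)*b), (1, a*c*a*b*a*(b*b)*a),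
   (-2, a*(a*a)*b*b*(b*c)*a), (1, a*(a*b)*a*a*(b*b)*c), (-2, a*(a*b)*a*b*(a*c)*b),
   (-4, a*(a*b)*a*b*(b*c)*a), (-2, a*(a*b)*b*a*(a*b)*c), (2, a*(a*b)*b*a*(a*c)*b),
   (4, a*(a*b)*b*a*(b*c)*a), (4, a*(a*b)*b*b*(a*c)*a), (-2, a*(a*b)*c*a*(a*b)*b),
   (-1, a*(a*b)*c*a*(b*b)*a), (-2, a*a*a*a*b*b*(b*c)), (4, a*a*a*b*a*b*(b*c)),
   (-2, a*a*b*a*b*a*(b*c)), (2, a*a*b*a*b*b*(a*c)), (-2, a*a*b*b*a*b*(a*c)),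
   (2, a*a*b*b*c*a*(a*b)), (-1, a*a*b*c*a*a*(b*b)), (-2, a*a*b*c*b*a*(a*b)),
   (1, a*a*c*a*b*a*(b*b)), (1, a*b*a*a*c*a*(b*b)), (-2, a*b*a*b*a*b*(a*c)),
   (-2, a*b*a*b*c*a*(a*b)), (2, a*b*a*c*b*a*(a*b)), (2, a*b*b*a*b*a*(a*c)),
   (-2, a*b*b*a*c*a*(a*b)), (2, a*b*b*c*a*a*(a*b)), (-2, a*b*c*a*b*a*(a*b)),
   (-1, a*(a*b)*a*c*a*(b*b)), (2, a*(a*b)*b*a*b*(a*c)), (-2, a*(a*b)*b*b*a*(a*c)),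
   (2, a*(a*b)*b*c*a*(a*b)), (1, a*(a*c)*a*b*a*(b*b)), (-1, a*(a*c)*b*a*a*(b*b)),
   (-2, a*a*(a*b)*a*b*(b*c)), (2, a*a*(a*b)*b*a*(b*c))]


/-- The 296-term polynomial in the free nonassociative algebra on `a`, `b`, `c`. -/
noncomputable def specialIdentity431 (F : Type*) [Field F] :
    FreeNonUnitalNonAssocAlgebra F (Fin 3) :=
  let a := FreeNonUnitalNonAssocAlgebra.of F (0 : Fin 3)
  let b := FreeNonUnitalNonAssocAlgebra.of F (1 : Fin 3)
  let c := FreeNonUnitalNonAssocAlgebra.of F (2 : Fin 3)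
  ((specialTerms1 a b c ++ specialTerms2 a b c).map fun t => t.1 • t.2).sum

/-! Special side. In a dialgebra, `d ↦ d ⊣ e + e ⊢ d` is right multiplication by `e` for twice the
quasi-Jordan product. The bar identities erase the centers of right factors, so a left-normed
monomial with leading letter `a` becomes a sum of words around that one central `a`, its factors
being attached on the left or on the right. Every term of `f` is left-normed in this sense, with
right factors of degree at most two. Grouping terms by their last factor therefore gives a Horner
scheme on pairs of words (left and right of the center), and a finite computation finds that
everything cancels (`horner_specialTerms`). The translation is sound in every dialgebra
(`eval_horner`), so freeness is not used. The factors ½ are cleared by `two_pow_smul_lift`, since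
all terms have the same degree.

Semispecial side. In `NullExtension R`, a space `K ⊕ M` with `K` commutative, elements of `K` act on
`M` from the right only, and `M` does not act at all. The semispecial identities are then polynomial
identities in coordinates. The bimodule comes from the Albert algebra, an exceptional Jordan
algebra, which makes it a natural place for a special identity to fail; at an explicit integral
point one coordinate of `f` is `-8` (`sum_evalWitness`). Since the identities of an algebra form a
T-ideal, `f` is not a consequence of the semispecial ones. As `f` is linear in `c`, it also refutes
the analogue of Macdonald's theorem. -/

/-! ### The terms as elements of the free magma -/

/-- The terms of the special identity, as pairs (coefficient, monomial of the free magma). -/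
def specialTerms : List (ℤ × FreeMagma (Fin 3)) :=
  specialTerms1 (.of 0) (.of 1) (.of 2) ++ specialTerms2 (.of 0) (.of 1) (.of 2)

-- The term lists are uniform in the magma, so substitution commutes with them by unfolding alone.
-- This links the polynomial to syntax trees on which finite checks can be run.
set_option maxRecDepth 20000 in
theorem specialTerms_map_lift {M : Type*} [Mul M] (x : Fin 3 → M) :
    specialTerms1 (x 0) (x 1) (x 2) ++ specialTerms2 (x 0) (x 1) (x 2) =
      specialTerms.map fun t => (t.1, FreeMagma.lift x t.2) := rfl

/-- A numerical fingerprint of monomials that separates the terms of the special identity. -/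
def monomialHash : FreeMagma (Fin 3) → ℕ
  | .of x => x.val + 1
  | .mul v w => 64 * monomialHash v + monomialHash w % 61

theorem specialTerms_nodup : (specialTerms.map Prod.snd).Nodup := by
  -- Modulo 61 the letters have hashes 1, 2, 3 and the products `aa`, `ab`, `ac`, `bb`, `bc` have 4,
  -- 5, 6, 8, 9. The base 64 digits of the hash thus list the factors of a left-normed monomial, and
  -- comparing numbers replaces comparing trees.
  refine List.Nodup.of_map monomialHash ?_
  decide +kernel

theorem specialTerms_length : specialTerms.length = 296 := by decide +kernel

theorem specialTerms_coeff_ne_zero : ∀ t ∈ specialTerms, t.1 ≠ 0 := by decide +kernel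

theorem specialTerms_occ :
    ∀ t ∈ specialTerms, occ 0 t.2 = 4 ∧ occ 1 t.2 = 3 ∧ occ 2 t.2 = 1 := by
  decide +kernel

theorem specialTerms_freeMagma_length : ∀ t ∈ specialTerms, t.2.length = 8 := by
  decide +kernel

/-! ### The special identity as a sum of monomials -/

theorem FreeNonUnitalNonAssocAlgebra.single_eq_lift (F : Type*) [Field F] {X : Type*}
    (m : FreeMagma X) :
    (MonoidAlgebra.single m 1 : FreeNonUnitalNonAssocAlgebra F X) =
      FreeMagma.lift (FreeNonUnitalNonAssocAlgebra.of F) m := by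
  induction m with
  | ih1 y => rfl
  | ih2 v w hv hw => rw [map_mul, ← hv, ← hw, MonoidAlgebra.single_mul_single, one_mul]

theorem FreeNonUnitalNonAssocAlgebra.lift_magmaLift {F : Type*} [Field F] {X A : Type*}
    [NonUnitalNonAssocRing A] [Module F A] [IsScalarTower F A A] [SMulCommClass F A A]
    (x : X → A) (m : FreeMagma X) :
    FreeNonUnitalNonAssocAlgebra.lift F x (FreeMagma.lift (FreeNonUnitalNonAssocAlgebra.of F) m) =
      FreeMagma.lift x m := by
  induction m with
  | ih1 y => simp
  | ih2 v w hv hw => rw [map_mul, map_mul, map_mul, hv, hw]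

theorem specialIdentity431_eq (F : Type*) [Field F] : specialIdentity431 F =
    (specialTerms.map fun t =>
      t.1 • FreeMagma.lift (FreeNonUnitalNonAssocAlgebra.of F) t.2).sum := by
  simp only [specialIdentity431]
  rw [specialTerms_map_lift, List.map_map]
  rfl

theorem lift_specialIdentity431 {F A : Type*} [Field F] [NonUnitalNonAssocRing A] [Module F A]
    [IsScalarTower F A A] [SMulCommClass F A A] (x : Fin 3 → A) :
    FreeNonUnitalNonAssocAlgebra.lift F x (specialIdentity431 F) =
      (specialTerms.map fun t => t.1 • FreeMagma.lift x t.2).sum := by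
  rw [specialIdentity431_eq, map_list_sum, List.map_map]
  refine congrArg List.sum (List.map_congr_left fun t _ => ?_)
  simp only [Function.comp_apply, map_zsmul, FreeNonUnitalNonAssocAlgebra.lift_magmaLift]

/-- Distinct monomials cannot cancel, and in characteristic zero a nonzero integer coefficient stays
nonzero in `F`. -/
theorem support_coeff_sum_single {F X : Type*} [Field F] [CharZero F] [DecidableEq X]
    (L : List (ℤ × X)) (h : (L.map Prod.snd).Nodup) (h0 : ∀ t ∈ L, t.1 ≠ 0) :
    (L.map fun t => Finsupp.single t.2 (t.1 : F)).sum.support = (L.map Prod.snd).toFinset := by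
  induction L with
  | nil => simp
  | cons t L ih =>
    simp only [List.map_cons, List.nodup_cons, List.mem_cons, forall_eq_or_imp] at h h0
    have hs : (Finsupp.single t.2 (t.1 : F)).support = {t.2} :=
      Finsupp.support_single _ (Int.cast_ne_zero.mpr h0.1)
    rw [List.map_cons, List.sum_cons, Finsupp.support_add_eq, ih h.2 h0.2, hs, List.map_cons,
      List.toFinset_cons, Finset.insert_eq]
    rw [ih h.2 h0.2, hs, Finset.disjoint_singleton_left, List.mem_toFinset]
    exact h.1

theorem coeff_sum_magmaLift_of {F X : Type*} [Field F] (L : List (ℤ × FreeMagma X)) :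
    (L.map fun t => t.1 • FreeMagma.lift (FreeNonUnitalNonAssocAlgebra.of F) t.2).sum.coeff =
      (L.map fun t => Finsupp.single t.2 (t.1 : F)).sum := by
  induction L with
  | nil => rfl
  | cons t L ih =>
    rw [List.map_cons, List.sum_cons, List.map_cons, List.sum_cons, MonoidAlgebra.coeff_add, ih,
      ← FreeNonUnitalNonAssocAlgebra.single_eq_lift]
    congr 1
    change t.1 • Finsupp.single t.2 (1 : F) = _
    rw [Finsupp.smul_single, zsmul_one]

theorem support_specialIdentity431 (F : Type*) [Field F] [CharZero F] :
    (specialIdentity431 F).coeff.support = (specialTerms.map Prod.snd).toFinset := by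
  rw [← support_coeff_sum_single (F := F) _ specialTerms_nodup specialTerms_coeff_ne_zero,
    specialIdentity431_eq, coeff_sum_magmaLift_of]

theorem card_support_specialIdentity431 (F : Type*) [Field F] [CharZero F] :
    (specialIdentity431 F).coeff.support.card = 296 := by
  rw [support_specialIdentity431, List.toFinset_card_of_nodup specialTerms_nodup, List.length_map,
    specialTerms_length]

theorem occ_of_mem_support_specialIdentity431 (F : Type*) [Field F] [CharZero F]
    (m : FreeMagma (Fin 3)) (hm : m ∈ (specialIdentity431 F).coeff.support) :
    occ 0 m = 4 ∧ occ 1 m = 3 ∧ occ 2 m = 1 := by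
  rw [support_specialIdentity431, List.mem_toFinset, List.mem_map] at hm
  obtain ⟨t, ht, rfl⟩ := hm
  exact specialTerms_occ t ht

/-! ### Identities of an algebra form a T-ideal -/

/-- An endomorphism followed by an evaluation is an evaluation at another point; this is why
identities are stable under endomorphisms. -/
theorem lift_comp_map {F X A : Type*} [Field F] [NonUnitalNonAssocRing A] [Module F A]
    [IsScalarTower F A A] [SMulCommClass F A A]
    (φ : FreeNonUnitalNonAssocAlgebra F X →ₙₐ[F] FreeNonUnitalNonAssocAlgebra F X) (x : X → A) :
    (FreeNonUnitalNonAssocAlgebra.lift F x).comp φ = FreeNonUnitalNonAssocAlgebra.lift F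
      (fun y => FreeNonUnitalNonAssocAlgebra.lift F x
        (φ (FreeNonUnitalNonAssocAlgebra.of F y))) :=
  FreeNonUnitalNonAssocAlgebra.hom_ext F fun y => by simp

/-- The polynomials that vanish identically on `A`. -/
def identitiesOf (F X A : Type*) [Field F] [NonUnitalNonAssocRing A] [Module F A]
    [IsScalarTower F A A] [SMulCommClass F A A] :
    Submodule F (FreeNonUnitalNonAssocAlgebra F X) where
  carrier := {f | Satisfies A f}
  add_mem' hf hg x := by rw [map_add, hf x, hg x, add_zero]
  zero_mem' x := map_zero _
  smul_mem' r f hf x := by rw [map_smul, hf x, smul_zero]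

theorem isTIdeal_identitiesOf (F X A : Type*) [Field F] [NonUnitalNonAssocRing A] [Module F A]
    [IsScalarTower F A A] [SMulCommClass F A A] : IsTIdeal (identitiesOf F X A) where
  mul_left f g hf x := by rw [map_mul, hf x, mul_zero]
  mul_right f g hf x := by rw [map_mul, hf x, zero_mul]
  map_mem φ f hf x := by
    rw [← NonUnitalAlgHom.comp_apply, lift_comp_map]
    exact hf _

/-- The identities of `A` form a T-ideal, and it contains the three generators, hence also the
smallest such T-ideal. -/
theorem Satisfies.of_mem_tIdeal_semispecialIdentities {F A : Type*} [Field F]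
    [NonUnitalNonAssocRing A] [Module F A] [IsScalarTower F A A] [SMulCommClass F A A]
    (hA : IsSemispecial A) {f : FreeNonUnitalNonAssocAlgebra F (Fin 3)}
    (hf : f ∈ tIdeal (semispecialIdentities F)) : Satisfies A f := by
  refine Submodule.mem_sInf.mp hf (identitiesOf F (Fin 3) A) ⟨isTIdeal_identitiesOf F (Fin 3) A, ?_⟩
  rintro g (rfl | rfl | rfl) x
  · simp [hA.right_comm]
  · simp [hA.quasi_jordan]
  · have := hA.associator_derivation (x 0) (x 1) (x 2)
    simp only [associator_apply] at this
    simp [associator_apply, map_nsmul, this]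

/-! ### A semispecial algebra -/

/-- The underlying space `M₃(R) ⊕ R³ ⊕ R³ ⊕ R³` of `NullExtension R`. -/
abbrev NullExtensionSpace (R : Type*) : Type _ :=
  ((R × R × R) × (R × R × R) × (R × R × R)) × (R × R × R) × (R × R × R) × (R × R × R)

/-- The null extension `K ⊕ M`, where `K` is a Jordan algebra with underlying space `M₃(R) ⊕ R³` and
`M = R³ ⊕ R³` is a bimodule over `K`; both are cut out of the first Tits construction of the split
Albert algebra. -/
def NullExtension (R : Type*) : Type _ := NullExtensionSpace R

namespace NullExtension

/-- The product `(X, w, p, q) (Y, z, p', q') = (XY + YX, X* z + Y* w, Y* p, Y⁺ q + z × p)`, where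
`X* = tr X - Xᵀ` and `X⁺ = tr X - X`. -/
def product {R : Type*} [Add R] [Sub R] [Mul R] :
    NullExtensionSpace R → NullExtensionSpace R → NullExtensionSpace R
  | (((a11, a12, a13), (a21, a22, a23), (a31, a32, a33)), (w1, w2, w3), (p1, p2, p3), (q1, q2, q3)),
    (((b11, b12, b13), (b21, b22, b23), (b31, b32, b33)), (z1, z2, z3), _, _) =>
    (((a11 * b11 + a12 * b21 + a13 * b31 + (b11 * a11 + b12 * a21 + b13 * a31),
       a11 * b12 + a12 * b22 + a13 * b32 + (b11 * a12 + b12 * a22 + b13 * a32),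
       a11 * b13 + a12 * b23 + a13 * b33 + (b11 * a13 + b12 * a23 + b13 * a33)),
      (a21 * b11 + a22 * b21 + a23 * b31 + (b21 * a11 + b22 * a21 + b23 * a31),
       a21 * b12 + a22 * b22 + a23 * b32 + (b21 * a12 + b22 * a22 + b23 * a32),
       a21 * b13 + a22 * b23 + a23 * b33 + (b21 * a13 + b22 * a23 + b23 * a33)),
      (a31 * b11 + a32 * b21 + a33 * b31 + (b31 * a11 + b32 * a21 + b33 * a31),
       a31 * b12 + a32 * b22 + a33 * b32 + (b31 * a12 + b32 * a22 + b33 * a32),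
       a31 * b13 + a32 * b23 + a33 * b33 + (b31 * a13 + b32 * a23 + b33 * a33))),
     ((a22 + a33) * z1 - a21 * z2 - a31 * z3 + ((b22 + b33) * w1 - b21 * w2 - b31 * w3),
      (a11 + a33) * z2 - a12 * z1 - a32 * z3 + ((b11 + b33) * w2 - b12 * w1 - b32 * w3),
      (a11 + a22) * z3 - a13 * z1 - a23 * z2 + ((b11 + b22) * w3 - b13 * w1 - b23 * w2)),
     ((b22 + b33) * p1 - b21 * p2 - b31 * p3,
      (b11 + b33) * p2 - b12 * p1 - b32 * p3,
      (b11 + b22) * p3 - b13 * p1 - b23 * p2),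
     ((b22 + b33) * q1 - b12 * q2 - b13 * q3 + (z2 * p3 - z3 * p2),
      (b11 + b33) * q2 - b21 * q1 - b23 * q3 + (z3 * p1 - z1 * p3),
      (b11 + b22) * q3 - b31 * q1 - b32 * q2 + (z1 * p2 - z2 * p1)))

theorem product_add {R : Type*} [CommRing R] (x y z : NullExtensionSpace R) :
    product x (y + z) = product x y + product x z := by
  obtain ⟨⟨⟨_, _, _⟩, ⟨_, _, _⟩, ⟨_, _, _⟩⟩, ⟨_, _, _⟩, ⟨_, _, _⟩, ⟨_, _, _⟩⟩ := x
  obtain ⟨⟨⟨_, _, _⟩, ⟨_, _, _⟩, ⟨_, _, _⟩⟩, ⟨_, _, _⟩, ⟨_, _, _⟩, ⟨_, _, _⟩⟩ := y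
  obtain ⟨⟨⟨_, _, _⟩, ⟨_, _, _⟩, ⟨_, _, _⟩⟩, ⟨_, _, _⟩, ⟨_, _, _⟩, ⟨_, _, _⟩⟩ := z
  simp only [product, Prod.mk_add_mk, Prod.mk.injEq]
  refine ⟨⟨⟨?_, ?_, ?_⟩, ⟨?_, ?_, ?_⟩, ?_, ?_, ?_⟩, ⟨?_, ?_, ?_⟩, ⟨?_, ?_, ?_⟩, ?_, ?_, ?_⟩ <;> ring

theorem add_product {R : Type*} [CommRing R] (x y z : NullExtensionSpace R) :
    product (x + y) z = product x z + product y z := by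
  obtain ⟨⟨⟨_, _, _⟩, ⟨_, _, _⟩, ⟨_, _, _⟩⟩, ⟨_, _, _⟩, ⟨_, _, _⟩, ⟨_, _, _⟩⟩ := x
  obtain ⟨⟨⟨_, _, _⟩, ⟨_, _, _⟩, ⟨_, _, _⟩⟩, ⟨_, _, _⟩, ⟨_, _, _⟩, ⟨_, _, _⟩⟩ := y
  obtain ⟨⟨⟨_, _, _⟩, ⟨_, _, _⟩, ⟨_, _, _⟩⟩, ⟨_, _, _⟩, ⟨_, _, _⟩, ⟨_, _, _⟩⟩ := z
  simp only [product, Prod.mk_add_mk, Prod.mk.injEq]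
  refine ⟨⟨⟨?_, ?_, ?_⟩, ⟨?_, ?_, ?_⟩, ?_, ?_, ?_⟩, ⟨?_, ?_, ?_⟩, ⟨?_, ?_, ?_⟩, ?_, ?_, ?_⟩ <;> ring

/-- A right factor acts only through its matrix and its first vector, and on these two components
the product is commutative. -/
theorem product_product_comm {R : Type*} [CommRing R] (x y z : NullExtensionSpace R) :
    product x (product y z) = product x (product z y) := by
  obtain ⟨⟨⟨_, _, _⟩, ⟨_, _, _⟩, ⟨_, _, _⟩⟩, ⟨_, _, _⟩, ⟨_, _, _⟩, ⟨_, _, _⟩⟩ := x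
  obtain ⟨⟨⟨_, _, _⟩, ⟨_, _, _⟩, ⟨_, _, _⟩⟩, ⟨_, _, _⟩, ⟨_, _, _⟩, ⟨_, _, _⟩⟩ := y
  obtain ⟨⟨⟨_, _, _⟩, ⟨_, _, _⟩, ⟨_, _, _⟩⟩, ⟨_, _, _⟩, ⟨_, _, _⟩, ⟨_, _, _⟩⟩ := z
  simp only [product, Prod.mk.injEq]
  refine ⟨⟨⟨?_, ?_, ?_⟩, ⟨?_, ?_, ?_⟩, ?_, ?_, ?_⟩, ⟨?_, ?_, ?_⟩, ⟨?_, ?_, ?_⟩, ?_, ?_, ?_⟩ <;> ring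

/-- Right multiplications by `x` and by `x²` commute: this is the Jordan identity on `K` and a
bimodule identity on `M`. -/
theorem product_quasi_jordan {R : Type*} [CommRing R] (x y : NullExtensionSpace R) :
    product (product y x) (product x x) = product (product y (product x x)) x := by
  obtain ⟨⟨⟨_, _, _⟩, ⟨_, _, _⟩, ⟨_, _, _⟩⟩, ⟨_, _, _⟩, ⟨_, _, _⟩, ⟨_, _, _⟩⟩ := x
  obtain ⟨⟨⟨_, _, _⟩, ⟨_, _, _⟩, ⟨_, _, _⟩⟩, ⟨_, _, _⟩, ⟨_, _, _⟩, ⟨_, _, _⟩⟩ := y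
  simp only [product, Prod.mk.injEq]
  refine ⟨⟨⟨?_, ?_, ?_⟩, ⟨?_, ?_, ?_⟩, ?_, ?_, ?_⟩, ⟨?_, ?_, ?_⟩, ⟨?_, ?_, ?_⟩, ?_, ?_, ?_⟩ <;> ring

/-- The map `x ↦ (y, x, z)` behaves as a derivation on squares. Negative terms are moved across, so
that only sums of products occur. -/
theorem product_associator_derivation {R : Type*} [CommRing R] (x y z : NullExtensionSpace R) :
    product (product y (product x x)) z +
        (product (product y (product x z)) x + product (product y (product x z)) x) =
      product (product (product y x) z) x + product (product (product y x) z) x +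
        product y (product (product x x) z) := by
  obtain ⟨⟨⟨_, _, _⟩, ⟨_, _, _⟩, ⟨_, _, _⟩⟩, ⟨_, _, _⟩, ⟨_, _, _⟩, ⟨_, _, _⟩⟩ := x
  obtain ⟨⟨⟨_, _, _⟩, ⟨_, _, _⟩, ⟨_, _, _⟩⟩, ⟨_, _, _⟩, ⟨_, _, _⟩, ⟨_, _, _⟩⟩ := y
  obtain ⟨⟨⟨_, _, _⟩, ⟨_, _, _⟩, ⟨_, _, _⟩⟩, ⟨_, _, _⟩, ⟨_, _, _⟩, ⟨_, _, _⟩⟩ := z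
  simp only [product, Prod.mk_add_mk, Prod.mk.injEq]
  refine ⟨⟨⟨?_, ?_, ?_⟩, ⟨?_, ?_, ?_⟩, ?_, ?_, ?_⟩, ⟨?_, ?_, ?_⟩, ⟨?_, ?_, ?_⟩, ?_, ?_, ?_⟩ <;> ring

instance {R : Type*} [AddCommGroup R] : AddCommGroup (NullExtension R) :=
  inferInstanceAs (AddCommGroup (NullExtensionSpace R))

instance {F R : Type*} [Semiring F] [AddCommGroup R] [Module F R] : Module F (NullExtension R) :=
  inferInstanceAs (Module F (NullExtensionSpace R))

section CommRing

variable {R : Type*} [CommRing R]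

theorem smul_product {F : Type*} [CommSemiring F] [Algebra F R] (r : F)
    (x y : NullExtensionSpace R) :
    product (r • x) y = r • product x y := by
  obtain ⟨⟨⟨_, _, _⟩, ⟨_, _, _⟩, ⟨_, _, _⟩⟩, ⟨_, _, _⟩, ⟨_, _, _⟩, ⟨_, _, _⟩⟩ := x
  obtain ⟨⟨⟨_, _, _⟩, ⟨_, _, _⟩, ⟨_, _, _⟩⟩, ⟨_, _, _⟩, ⟨_, _, _⟩, ⟨_, _, _⟩⟩ := y
  simp only [product, Prod.smul_mk, smul_add, smul_sub, smul_mul_assoc, mul_smul_comm,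
    add_mul]

theorem product_smul {F : Type*} [CommSemiring F] [Algebra F R] (r : F)
    (x y : NullExtensionSpace R) :
    product x (r • y) = r • product x y := by
  obtain ⟨⟨⟨_, _, _⟩, ⟨_, _, _⟩, ⟨_, _, _⟩⟩, ⟨_, _, _⟩, ⟨_, _, _⟩, ⟨_, _, _⟩⟩ := x
  obtain ⟨⟨⟨_, _, _⟩, ⟨_, _, _⟩, ⟨_, _, _⟩⟩, ⟨_, _, _⟩, ⟨_, _, _⟩, ⟨_, _, _⟩⟩ := y
  simp only [product, Prod.smul_mk, smul_add, smul_sub, smul_mul_assoc, mul_smul_comm,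
    add_mul]

instance : NonUnitalNonAssocRing (NullExtension R) :=
  { (inferInstance : AddCommGroup (NullExtension R)) with
    mul := product
    left_distrib := product_add
    right_distrib := add_product
    zero_mul := fun x => by
      have := smul_product (0 : R) 0 x
      rwa [zero_smul, zero_smul] at this
    mul_zero := fun x => by
      have := product_smul (0 : R) x 0
      rwa [zero_smul, zero_smul] at this }

instance {F : Type*} [CommSemiring F] [Algebra F R] :
    IsScalarTower F (NullExtension R) (NullExtension R) := ⟨smul_product⟩

instance {F : Type*} [CommSemiring F] [Algebra F R] :
    SMulCommClass F (NullExtension R) (NullExtension R) :=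
  ⟨fun r x y => (product_smul r x y).symm⟩

variable (R) in
theorem isSemispecial : IsSemispecial (NullExtension R) where
  right_comm := product_product_comm
  quasi_jordan x y := product_quasi_jordan x y
  associator_derivation x y z := by
    have h : y * (x * x) * z + (y * (x * z) * x + y * (x * z) * x) =
      y * x * z * x + y * x * z * x + y * (x * x * z) := product_associator_derivation x y z
    rw [associator_apply, associator_apply, sub_mul, two_nsmul, sub_eq_iff_eq_add, ← sub_eq_zero]
    rw [← sub_eq_zero] at h
    rw [← h]
    abel

/-- The last coordinate. -/
def last : NullExtension R →+ R where
  toFun x := x.2.2.2.2.2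
  map_zero' := rfl
  map_add' _ _ := rfl

variable (R) in
/-- The coordinatewise cast. -/
def intCast : NullExtensionSpace ℤ → NullExtension R
  | (((a11, a12, a13), (a21, a22, a23), (a31, a32, a33)), (w1, w2, w3), (p1, p2, p3),
      (q1, q2, q3)) =>
    (((a11, a12, a13), (a21, a22, a23), (a31, a32, a33)), (w1, w2, w3), (p1, p2, p3), (q1, q2, q3))

/-- The coordinates of a product are integral polynomials in those of the factors, so one
computation over `ℤ` serves every `R`. -/
theorem intCast_mul (x y : NullExtensionSpace ℤ) :
    intCast R (product x y) = intCast R x * intCast R y := by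
  obtain ⟨⟨⟨_, _, _⟩, ⟨_, _, _⟩, ⟨_, _, _⟩⟩, ⟨_, _, _⟩, ⟨_, _, _⟩, ⟨_, _, _⟩⟩ := x
  obtain ⟨⟨⟨_, _, _⟩, ⟨_, _, _⟩, ⟨_, _, _⟩⟩, ⟨_, _, _⟩, ⟨_, _, _⟩, ⟨_, _, _⟩⟩ := y
  simp only [product, intCast, Int.cast_add, Int.cast_sub, Int.cast_mul]
  rfl

end CommRing

/-! ### Non-vanishing of the special identity on the null extension -/

/-- Three elements at which the special identity does not vanish. -/
def witness : Fin 3 → NullExtensionSpace ℤ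
  | 0 => (((0, 0, 0), (0, 0, 1), (1, 0, 0)), (0, 0, 0), (1, 0, 0), (0, 0, 0))
  | 1 => (((0, 1, 0), (0, 0, 1), (0, 0, 0)), (0, 0, 0), (0, 0, 0), (0, 0, 0))
  | 2 => (((0, 0, 0), (0, 0, 0), (0, 0, 0)), (0, 1, 0), (0, 0, 0), (0, 0, 0))

/-- The value of a monomial at `witness`. -/
def evalWitness : FreeMagma (Fin 3) → NullExtensionSpace ℤ
  | .of i => witness i
  | .mul v w => product (evalWitness v) (evalWitness w)

theorem intCast_evalWitness (R : Type*) [CommRing R] (m : FreeMagma (Fin 3)) :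
    intCast R (evalWitness m) = FreeMagma.lift (fun i => intCast R (witness i)) m := by
  induction m with
  | ih1 i => rfl
  | ih2 v w hv hw => rw [map_mul, ← hv, ← hw, ← intCast_mul]; rfl

/-- At the witness only `a` has a component `p` and only `c` a component `w`. As `c` has no matrix
part, it enters only through the cross product that carries `p` to `q`, so the value has to be
looked for in `q`. -/
theorem sum_evalWitness :
    (specialTerms.map fun t => t.1 * (evalWitness t.2).2.2.2.2.2).sum = -8 := by
  decide +kernel

theorem last_lift_witness (F R : Type*) [Field F] [CommRing R] [Algebra F R] :
    last (FreeNonUnitalNonAssocAlgebra.lift F (fun i => intCast R (witness i))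
      (specialIdentity431 F)) = -8 := by
  have h : ∀ L : List (ℤ × FreeMagma (Fin 3)),
      (L.map fun t => last (t.1 • intCast R (evalWitness t.2))).sum =
        ((L.map fun t => t.1 * (evalWitness t.2).2.2.2.2.2).sum : ℤ) := by
    intro L
    induction L with
    | nil => simp
    | cons t L ih =>
      rw [List.map_cons, List.sum_cons, ih, List.map_cons, List.sum_cons, Int.cast_add,
        Int.cast_mul, map_zsmul, zsmul_eq_mul]
      rfl
  rw [lift_specialIdentity431, map_list_sum, List.map_map]
  refine Eq.trans ?_ ((h specialTerms).trans (by rw [sum_evalWitness]; norm_num))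
  refine congrArg List.sum (List.map_congr_left fun t _ => ?_)
  rw [Function.comp_apply, intCast_evalWitness]

theorem not_satisfies (F R : Type*) [Field F] [CommRing R] [CharZero R] [Algebra F R] :
    ¬ Satisfies (NullExtension R) (specialIdentity431 F) := fun h => by
  have := last_lift_witness F R
  rw [h, map_zero] at this
  norm_num at this

end NullExtension

theorem specialIdentity431_notMem_tIdeal (F : Type*) [Field F] [CharZero F] :
    specialIdentity431 F ∉ tIdeal (semispecialIdentities F) := fun h =>
  NullExtension.not_satisfies F F
    (Satisfies.of_mem_tIdeal_semispecialIdentities (NullExtension.isSemispecial F) h)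

theorem not_holdsInSemispecial_specialIdentity431 :
    ¬ HoldsInSemispecial.{u} (specialIdentity431 ℚ) := fun h =>
  -- The counterexample has to live in universe `u`, hence the lifted coefficients.
  haveI : CharZero (ULift.{u} ℚ) :=
    ⟨fun _ _ h => Nat.cast_injective (R := ℚ) (congrArg ULift.down h)⟩
  NullExtension.not_satisfies ℚ (ULift.{u} ℚ)
    (h (NullExtension (ULift.{u} ℚ)) (NullExtension.isSemispecial _))

/-! ### Values of monomials in the plus algebra of a dialgebra -/

namespace AssocDialgebra

variable {F D : Type*} [Field F] [AddCommGroup D] [Module F D] [AssocDialgebra F D]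

variable (F) in
/-- The value of a nonassociative monomial with respect to the product `a ⊣ b + b ⊢ a`. -/
def doubledEval {X : Type*} (φ : X → D) : FreeMagma X → D
  | .of x => φ x
  | .mul v w => left (F := F) (doubledEval φ v) (doubledEval φ w) +
      right (F := F) (doubledEval φ w) (doubledEval φ v)

/-- A monomial of degree `n` involves `n - 1` products, each with a factor ½. The extra factor 2 on
both sides keeps the power multiplicative in the monomial. -/
theorem two_pow_smul_lift {X : Type*} (h : (2 : F) ≠ 0) (φ : X → PlusAlgebra F D)
    (m : FreeMagma X) :
    (2 ^ m.length : F) • FreeMagma.lift φ m =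
      (2 : F) • (doubledEval (D := D) F φ m : PlusAlgebra F D) := by
  induction m with
  | ih1 x => simp [FreeMagma.length]; rfl
  | ih2 v w hv hw =>
    have key : ∀ (r s : F) (a b a' b' c : PlusAlgebra F D), r • a = (2 : F) • a' →
        s • b = (2 : F) • b' → c = (2 : F) • (a' * b') → (r * s) • (a * b) = (2 : F) • c := by
      rintro r s a b a' b' _ ha hb rfl
      rw [mul_smul, ← mul_smul_comm, ← smul_mul_assoc, ha, hb, smul_mul_assoc, mul_smul_comm]
    have e : doubledEval (D := D) F φ (v * w) =
        (2 : F) • PlusAlgebra.quasiJordanMul F D (doubledEval (D := D) F φ v)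
          (doubledEval (D := D) F φ w) := by
      rw [PlusAlgebra.quasiJordanMul_apply, smul_inv_smul₀ h]
      rfl
    rw [map_mul, show (2 ^ (v * w).length : F) = 2 ^ v.length * 2 ^ w.length from pow_add _ _ _]
    exact key _ _ _ _ _ _ _ hv hw e

/-- Right multiplication by `e` with respect to the product `a ⊣ b + b ⊢ a`. -/
def doubledMulRight (e : D) : D →ₗ[F] D := (left (F := F)).flip e + right (F := F) e

theorem doubledMulRight_apply (d e : D) :
    doubledMulRight (F := F) e d = left (F := F) d e + right (F := F) e d := rfl

/-- By the bar identities a product acting from outside is just a word, whichever operations formed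
it. A right factor of degree two can therefore be applied letter by letter, in both orders and on
both sides. -/
theorem doubledMulRight_left_add_right (d e e' : D) :
    doubledMulRight (F := F) (left (F := F) e e' + right (F := F) e' e) d =
      right (F := F) e (right (F := F) e' d) + right (F := F) e' (right (F := F) e d) +
        (left (F := F) (left (F := F) d e) e' + left (F := F) (left (F := F) d e') e) := by
  rw [doubledMulRight_apply, map_add, map_add, LinearMap.add_apply, ← right_bar, right_assoc,
    right_assoc, ← left_bar, ← left_assoc, ← left_assoc]
  abel

end AssocDialgebra

/-! ### Computing in the free associative dialgebra -/

/-- Integral combinations of dialgebra monomials with center `0`. The entry `(m, n, k)` stands for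
`k` times the monomial whose left and right part have the codes `m` and `n`. -/
abbrev MarkedPoly := List (ℕ × ℕ × ℤ)

namespace MarkedPoly

/-- The word whose letters, from the first one on, are the base `4` digits of `n`, lowest first;
the letter `x` has the digit `x + 1`. -/
def decode (n : ℕ) : List (Fin 3) := (Nat.digits 4 n).map fun d => Fin.ofNat 3 (d + 2)

theorem decode_cons (x : Fin 3) (n : ℕ) : decode (4 * n + (x + 1)) = x :: decode n := by
  -- The digit `x + 1` is never 0, so it survives even when `n = 0`, the code of the empty word.
  rw [decode, add_comm, Nat.digits_add 4 (by norm_num) _ _ (by omega) (Or.inl (by omega))]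
  rw [List.map_cons, decode]
  congr 1
  revert x
  decide

/-- Sum of two lists sorted by codes; `fuel` bounds the number of steps. -/
def merge : ℕ → MarkedPoly → MarkedPoly → MarkedPoly
  | 0, p, q => p ++ q
  | _ + 1, [], q => q
  | _ + 1, s :: p, [] => s :: p
  | fuel + 1, (m, n, k) :: p, (m', n', k') :: q =>
    bif Nat.beq m m' && Nat.beq n n' then
      bif decide (k + k' = 0) then merge fuel p q else (m, n, k + k') :: merge fuel p q
    else bif Nat.blt m m' || (Nat.beq m m' && Nat.blt n n') then
      (m, n, k) :: merge fuel p ((m', n', k') :: q)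
    else (m', n', k') :: merge fuel ((m, n, k) :: p) q

/-- Left multiplication by a letter. -/
def consLeft (x : Fin 3) (p : MarkedPoly) : MarkedPoly :=
  p.map fun s => (4 * s.1 + (x + 1), s.2)

/-- Right multiplication by a letter. -/
def consRight (x : Fin 3) (p : MarkedPoly) : MarkedPoly :=
  p.map fun s => (s.1, 4 * s.2.1 + (x + 1), s.2.2)

/-- The sum of two polynomials of degree at most `8` with the given center. -/
def add (p q : MarkedPoly) : MarkedPoly := merge 5000 p q

/-- Right multiplication by a monomial of degree at most `2`. -/
def mulRight : FreeMagma (Fin 3) → MarkedPoly → MarkedPoly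
  | .of x, p => add (consLeft x p) (consRight x p)
  | .mul (.of x) (.of y), p =>
    add (add (consLeft x (consLeft y p)) (consLeft y (consLeft x p)))
      (add (consRight y (consRight x p)) (consRight x (consRight y p)))
  -- Junk value: no other right factors occur in the special identity.
  | _, p => p

/-- The right factors that occur in the special identity. -/
def rightFactors : List (FreeMagma (Fin 3)) :=
  [.of 0, .of 1, .of 2, .of 0 * .of 0, .of 0 * .of 1, .of 0 * .of 2, .of 1 * .of 1, .of 1 * .of 2]

/-- The left factors of the terms with right factor `g`. -/
def strip (g : FreeMagma (Fin 3)) :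
    List (ℤ × FreeMagma (Fin 3)) → List (ℤ × FreeMagma (Fin 3))
  | [] => []
  | (k, .mul v w) :: L => bif decide (g = w) then (k, v) :: strip g L else strip g L
  | _ :: L => strip g L

/-- The terms of degree one. -/
def constants : List (ℤ × FreeMagma (Fin 3)) → MarkedPoly
  | [] => []
  -- The letter is taken to be the center `0`; `isLeftNormed` guarantees this where soundness needs
  -- it.
  | (k, .of _) :: L => (0, 0, k) :: constants L
  | _ :: L => constants L

/-- The value of a combination of monomials, computed by Horner's scheme. -/
def horner : ℕ → List (ℤ × FreeMagma (Fin 3)) → MarkedPoly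
  | _, [] => []
  | 0, L => constants L
  | n + 1, L => rightFactors.foldr (fun g p => add (mulRight g (horner n (strip g L))) p)
      (constants L)

/-- The only place where the coefficients of `f` enter the proof that it vanishes on special
algebras. -/
theorem horner_specialTerms : horner 8 specialTerms = [] := by decide +kernel

/-! ### Soundness of the computation in an arbitrary associative dialgebra -/

section Soundness

open AssocDialgebra FreeDialgebra

variable {F D : Type*} [Field F] [AddCommGroup D] [Module F D] [AssocDialgebra F D]

variable (F) in
/-- The monomial with the codes `m` and `n`, evaluated at `φ`. -/
def evalCode (φ : Fin 3 → D) (m n : ℕ) : D :=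
  evalMon (F := F) φ (decode m, 0, (decode n).reverse)

theorem evalCode_left (φ : Fin 3 → D) (x : Fin 3) (m n : ℕ) :
    evalCode F φ (4 * m + (x + 1)) n = right (F := F) (φ x) (evalCode F φ m n) := by
  rw [evalCode, decode_cons]
  rfl

/-- The right word is coded from its last letter backwards, so the outermost letter is the lowest
digit on both sides of the center. -/
theorem evalCode_right (φ : Fin 3 → D) (x : Fin 3) (m n : ℕ) :
    evalCode F φ m (4 * n + (x + 1)) = left (F := F) (evalCode F φ m n) (φ x) := by
  rw [evalCode, decode_cons, List.reverse_cons]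
  exact evalMon_leftMon φ (decode m, 0, (decode n).reverse) ([], x, [])

variable (F) in
/-- The value of a polynomial at `φ`. -/
def eval (φ : Fin 3 → D) (p : MarkedPoly) : D :=
  (p.map fun s => s.2.2 • evalCode F φ s.1 s.2.1).sum

theorem eval_nil (φ : Fin 3 → D) : eval F φ [] = 0 := rfl

theorem eval_cons (φ : Fin 3 → D) (s : ℕ × ℕ × ℤ) (p : MarkedPoly) :
    eval F φ (s :: p) = s.2.2 • evalCode F φ s.1 s.2.1 + eval F φ p := by
  rw [eval, List.map_cons, List.sum_cons, eval]

/-- Neither sortedness nor sufficient fuel matters here: when fuel runs out the lists are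
concatenated, and the order only decides how much cancels. -/
theorem eval_merge (φ : Fin 3 → D) (fuel : ℕ) (p q : MarkedPoly) :
    eval F φ (merge fuel p q) = eval F φ p + eval F φ q := by
  induction fuel generalizing p q with
  | zero => simp [merge, eval]
  | succ fuel ih =>
    obtain _ | ⟨⟨m, k, l⟩, p⟩ := p
    · simp [merge, eval]
    obtain _ | ⟨⟨m', k', l'⟩, q⟩ := q
    · simp [merge, eval]
    rw [merge]
    cases h1 : Nat.beq m m' && Nat.beq k k' with
    | true =>
      rw [Bool.and_eq_true, Nat.beq_eq, Nat.beq_eq] at h1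
      obtain ⟨rfl, rfl⟩ := h1
      rw [cond_true, eval_cons, eval_cons]
      have e : l • evalCode F φ m k + eval F φ p + (l' • evalCode F φ m k + eval F φ q) =
        (l + l') • evalCode F φ m k + (eval F φ p + eval F φ q) := by rw [add_smul]; abel
      rw [e, ← ih]
      by_cases h2 : l + l' = 0
      · simp [h2]
      · simp [h2, eval_cons]
    | false =>
      rw [cond_false]
      cases Nat.blt m m' || (Nat.beq m m' && Nat.blt k k') with
      | true => rw [cond_true, eval_cons, ih, eval_cons φ (m, k, l), add_assoc]
      | false => rw [cond_false, eval_cons, ih, eval_cons φ (m', k', l'), add_left_comm]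

theorem eval_add (φ : Fin 3 → D) (p q : MarkedPoly) :
    eval F φ (add p q) = eval F φ p + eval F φ q := eval_merge φ _ p q

theorem eval_consLeft (φ : Fin 3 → D) (x : Fin 3) (p : MarkedPoly) :
    eval F φ (consLeft x p) = right (F := F) (φ x) (eval F φ p) := by
  induction p with
  | nil => exact (map_zero _).symm
  | cons s p ih =>
    rw [eval_cons, map_add, ← ih, map_zsmul, ← evalCode_left]
    exact eval_cons ..

theorem eval_consRight (φ : Fin 3 → D) (x : Fin 3) (p : MarkedPoly) :
    eval F φ (consRight x p) = left (F := F) (eval F φ p) (φ x) := by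
  induction p with
  | nil => exact (LinearMap.map_zero₂ _ _).symm
  | cons s p ih =>
    rw [eval_cons, LinearMap.map_add₂, ← ih, map_zsmul, LinearMap.smul_apply, ← evalCode_right]
    exact eval_cons ..

theorem eval_mulRight (φ : Fin 3 → D) {g : FreeMagma (Fin 3)} (hg : g ∈ rightFactors)
    (p : MarkedPoly) :
    eval F φ (mulRight g p) = doubledMulRight (F := F) (doubledEval F φ g) (eval F φ p) := by
  have h1 : ∀ x, eval F φ (mulRight (.of x) p) =
      doubledMulRight (F := F) (doubledEval F φ (.of x)) (eval F φ p) := fun x => by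
    rw [mulRight, eval_add, eval_consLeft, eval_consRight, add_comm]
    rfl
  have h2 : ∀ x y, eval F φ (mulRight (.mul (.of x) (.of y)) p) =
      doubledMulRight (F := F) (doubledEval F φ (.mul (.of x) (.of y))) (eval F φ p) := by
    intro x y
    simp only [mulRight, eval_add, eval_consLeft, eval_consRight]
    exact (doubledMulRight_left_add_right _ _ _).symm
  simp only [rightFactors, List.mem_cons, List.not_mem_nil, or_false] at hg
  rcases hg with rfl | rfl | rfl | rfl | rfl | rfl | rfl | rfl
  exacts [h1 _, h1 _, h1 _, h2 _ _, h2 _ _, h2 _ _, h2 _ _, h2 _ _]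

/-- The left-normed monomials that start with the letter `0` and have at most `n` factors after it,
all of them in `rightFactors`. -/
def isLeftNormed : ℕ → FreeMagma (Fin 3) → Bool
  | _, .of x => decide (x = 0)
  | 0, .mul _ _ => false
  | n + 1, .mul v w => decide (w ∈ rightFactors) && isLeftNormed n v

variable (F) in
/-- The value of a combination of monomials with respect to the product `a ⊣ b + b ⊢ a`. -/
def evalTerms (φ : Fin 3 → D) (L : List (ℤ × FreeMagma (Fin 3))) : D :=
  (L.map fun t => t.1 • doubledEval F φ t.2).sum

/-- Right multiplication is linear, so terms with a common last factor can be collected. Each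
product falls into exactly one group, as `rightFactors` contains its right factor and has no
repetitions. -/
theorem evalTerms_eq_sum_strip (φ : Fin 3 → D) (n : ℕ) (L : List (ℤ × FreeMagma (Fin 3)))
    (h : ∀ t ∈ L, isLeftNormed n t.2) :
    evalTerms F φ L = eval F φ (constants L) + (rightFactors.map fun g =>
      doubledMulRight (F := F) (doubledEval F φ g) (evalTerms F φ (strip g L))).sum := by
  have hn : rightFactors.Nodup := by decide
  rw [← List.sum_toFinset _ hn]
  induction L with
  | nil => simp [evalTerms, constants, strip, eval]
  | cons t L ih =>
    specialize ih fun t ht => h t (List.mem_cons_of_mem _ ht)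
    have ht := h t List.mem_cons_self
    have e : ∀ (k : ℤ) (m : FreeMagma (Fin 3)) (L : List (ℤ × FreeMagma (Fin 3))),
        evalTerms F φ ((k, m) :: L) = k • doubledEval F φ m + evalTerms F φ L := fun k m L => by
      simp [evalTerms]
    obtain ⟨k, x | ⟨v, w⟩⟩ := t
    · have hx : x = 0 := by cases n <;> simpa [isLeftNormed] using ht
      subst hx
      rw [e, ih, constants, eval_cons, add_assoc]
      congr 2
    · obtain _ | n := n
      · simp [isLeftNormed] at ht
      have hw : w ∈ rightFactors := by
        simp only [isLeftNormed, Bool.and_eq_true, decide_eq_true_eq] at ht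
        exact ht.1
      have e' : ∀ g ∈ rightFactors.toFinset, doubledMulRight (F := F) (doubledEval F φ g)
            (evalTerms F φ (strip g ((k, .mul v w) :: L))) =
          (if g = w then k • doubledEval F φ (.mul v w) else 0) +
            doubledMulRight (F := F) (doubledEval F φ g) (evalTerms F φ (strip g L)) := by
        intro g _
        by_cases hg : g = w
        · subst hg
          rw [strip, decide_eq_true rfl, cond_true, e, map_add, map_zsmul, if_pos rfl]
          rfl
        · rw [strip, decide_eq_false hg, cond_false, if_neg hg, zero_add]
      rw [Finset.sum_congr rfl e', Finset.sum_add_distrib, Finset.sum_ite_eq', e, ih,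
        if_pos (List.mem_toFinset.mpr hw), constants]
      · abel
      · simp

theorem isLeftNormed_of_mem_strip {g : FreeMagma (Fin 3)} {n : ℕ}
    {L : List (ℤ × FreeMagma (Fin 3))} (h : ∀ t ∈ L, isLeftNormed (n + 1) t.2) :
    ∀ t ∈ strip g L, isLeftNormed n t.2 := by
  induction L with
  | nil => simp [strip]
  | cons t L ih =>
    specialize ih fun t ht => h t (List.mem_cons_of_mem _ ht)
    have ht := h t List.mem_cons_self
    obtain ⟨k, x | ⟨v, w⟩⟩ := t
    · exact ih
    · rw [strip]
      cases decide (g = w) with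
      | true =>
        simp only [isLeftNormed, Bool.and_eq_true] at ht
        simp only [cond_true, List.mem_cons, forall_eq_or_imp]
        exact ⟨ht.2, ih⟩
      | false => exact ih

theorem eval_horner (φ : Fin 3 → D) (n : ℕ) (L : List (ℤ × FreeMagma (Fin 3)))
    (h : ∀ t ∈ L, isLeftNormed n t.2) : eval F φ (horner n L) = evalTerms F φ L := by
  have hfold : ∀ (f : FreeMagma (Fin 3) → MarkedPoly) (p : MarkedPoly)
      (G : List (FreeMagma (Fin 3))), eval F φ (G.foldr (fun g p => add (f g) p) p) =
        eval F φ p + (G.map fun g => eval F φ (f g)).sum := fun f p G => by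
    induction G with
    | nil => simp
    | cons g G ih => rw [List.foldr_cons, eval_add, ih, List.map_cons, List.sum_cons]; abel
  induction n generalizing L with
  | zero =>
    cases L with
    | nil => rfl
    | cons t L =>
      rw [evalTerms_eq_sum_strip φ 0 _ h, horner]
      -- With no right factors allowed, every term is a single letter and nothing is left to strip.
      · have hs : ∀ (g) (L : List (ℤ × FreeMagma (Fin 3))), (∀ t ∈ L, isLeftNormed 0 t.2) →
            strip g L = [] := fun g L => by
          induction L with
          | nil => simp [strip]
          | cons t L ih =>
            intro h
            obtain ⟨k, x | ⟨v, w⟩⟩ := t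
            · exact ih fun t ht => h t (List.mem_cons_of_mem _ ht)
            · simpa [isLeftNormed] using h _ List.mem_cons_self
        simp [hs _ _ h, evalTerms]
      · simp
  | succ n ih =>
    cases L with
    | nil => rfl
    | cons t L =>
      rw [evalTerms_eq_sum_strip φ _ _ h, horner, hfold]
      · congr 2
        refine List.map_congr_left fun g hg => ?_
        rw [eval_mulRight φ hg, ih _ (isLeftNormed_of_mem_strip h)]
      · simp

theorem isLeftNormed_specialTerms : ∀ t ∈ specialTerms, isLeftNormed 8 t.2 := by decide +kernel

theorem evalTerms_specialTerms (φ : Fin 3 → D) : evalTerms F φ specialTerms = 0 := by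
  rw [← eval_horner φ 8 _ isLeftNormed_specialTerms, horner_specialTerms, eval_nil]

theorem sum_smul_doubledEval_specialTerms (r : F) (φ : Fin 3 → D) :
    (specialTerms.map fun t => r • t.1 • doubledEval F φ t.2).sum = 0 := by
  have := evalTerms_specialTerms (F := F) φ
  rw [evalTerms] at this
  rw [← smul_zero r, ← this, List.smul_sum, List.map_map]
  rfl

end Soundness

end MarkedPoly

/-! ### Specialness and the main theorem -/

theorem satisfies_plusAlgebra_specialIdentity431 {F D : Type*} [Field F] [AddCommGroup D]
    [Module F D] [AssocDialgebra F D] (h : (2 : F) ≠ 0) :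
    Satisfies (PlusAlgebra F D) (specialIdentity431 F) := fun x => by
  refine (smul_eq_zero_iff_right (pow_ne_zero 8 h)).mp ?_
  rw [lift_specialIdentity431, List.smul_sum, List.map_map]
  refine Eq.trans (congrArg List.sum (List.map_congr_left fun t ht => ?_))
    (MarkedPoly.sum_smul_doubledEval_specialTerms (D := D) (2 : F) x)
  rw [Function.comp_apply, smul_comm, ← specialTerms_freeMagma_length t ht,
    AssocDialgebra.two_pow_smul_lift h, smul_comm]
  rfl

/-- An injective homomorphism into a plus algebra reflects the vanishing of a value. -/
theorem holdsInSpecial_specialIdentity431 {F : Type*} [Field F] (h : (2 : F) ≠ 0) :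
    HoldsInSpecial.{u} (specialIdentity431 F) := by
  rintro A _ _ _ _ ⟨D, _, _, _, φ, hφ⟩ x
  apply hφ
  rw [map_zero, ← NonUnitalAlgHom.comp_apply,
    show φ.comp (FreeNonUnitalNonAssocAlgebra.lift F x) =
      FreeNonUnitalNonAssocAlgebra.lift F (fun i => φ (x i)) from
      FreeNonUnitalNonAssocAlgebra.hom_ext F fun i => by simp]
  exact satisfies_plusAlgebra_specialIdentity431 h _

theorem isSpecialIdentity_specialIdentity431 : IsSpecialIdentity.{u} (specialIdentity431 ℚ) :=
  ⟨holdsInSpecial_specialIdentity431 two_ne_zero, not_holdsInSemispecial_specialIdentity431⟩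

theorem mainTheorem3 :
    -- the polynomial has 296 terms and is homogeneous of multidegree `a⁴b³c`
    (specialIdentity431 ℚ).coeff.support.card = 296 ∧
    (∀ m ∈ (specialIdentity431 ℚ).coeff.support, occ 0 m = 4 ∧ occ 1 m = 3 ∧ occ 2 m = 1) ∧
    -- it collapses to zero in the free associative dialgebra
    FreeNonUnitalNonAssocAlgebra.lift ℚ (A := PlusAlgebra ℚ (FreeDialgebra ℚ (Fin 3)))
      (FreeDialgebra.of ℚ) (specialIdentity431 ℚ) = 0 ∧
    -- it is an identity for the quasi-Jordan product of every associative dialgebra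
    (∀ (D : Type u) [AddCommGroup D] [Module ℚ D] [AssocDialgebra ℚ D],
      Satisfies (PlusAlgebra ℚ D) (specialIdentity431 ℚ)) ∧
    -- it is not a consequence of the semispecial identities
    specialIdentity431 ℚ ∉ tIdeal (semispecialIdentities ℚ) ∧
    -- it is a special identity
    IsSpecialIdentity.{u} (specialIdentity431 ℚ) ∧
    -- the analogue of Macdonald's theorem fails
    ¬ MacdonaldAnalogue.{u} ℚ := by
  have hs := isSpecialIdentity_specialIdentity431.{u}
  refine ⟨card_support_specialIdentity431 ℚ, occ_of_mem_support_specialIdentity431 ℚ,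
    satisfies_plusAlgebra_specialIdentity431 two_ne_zero _,
    fun D _ _ _ => satisfies_plusAlgebra_specialIdentity431 two_ne_zero,
    specialIdentity431_notMem_tIdeal ℚ, hs, fun h => hs.2 (h _ (fun m hm => ?_) hs.1)⟩
  -- Linearity in `c` gives the degree bound in the third variable.
  exact (occ_of_mem_support_specialIdentity431 ℚ m hm).2.2.le
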